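/- **Setting.** Multi-indices lie in $\mathbb{N}^N$ with $\mathbb{N}=\{1,2,\dots\}$; $\bm 1=(1,\dots,1)$, $\bm e_n$ is the $n$-th unit vector. Let $D\subset\mathbb{R}^d$ be open and let $H^1_0(D;\mathbb K)$, $\mathbb K\in\{\mathbb R,\mathbb C\}$, be the closure of $C_c^\infty(D;\mathbb K)$ in $H^1(D;\mathbb K)$; write $V=H^1_0(D;\mathbb{R})$ and $\|v\|_V=\|\nabla v\|_{L^2(D)}$ (a norm equivalent to the $H^1$ norm when $D$ is bounded; the same notation is used for complex-valued $v$). Let $\Gamma=\prod_{n=1}^N\Gamma_n$ with compact intervals $\Gamma_n$ of length $|\Gamma_n|>0$, let $\rho=\bigotimes_n\rho_n$ with probability densities $\rho_n$ on $\Gamma_n$, and let $a(\bm y,x)=a_0(x)+\sum_{n=1}^N a_n(x)y_n$ with measurable $a_n$ and $0<a_{\min}\le a(\bm y,x)\le a_{\max}$ for $\rho$-a.e. $\bm y\in\Gamma$ and all $x\in D$. Let $\bm\tau\in\mathbb{R}_{>0}^N$ and $$\Sigma(\Gamma,\bm\tau)=\{\bm z\in\mathbb{C}^N:\operatorname{dist}(z_n,\Gamma_n)\le\tau_n\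 \forall n\},\qquad \sigma=\min_{n}\log\Big(\tfrac{2\tau_n}{|\Gamma_n|}+\sqrt{1+\tfrac{4\tau_n^2}{|\Gamma_n|^2}}\Big).$$ Let $m(0)=0$, $m(1)=1$, $m(i)=2^{i-1}+1$ for $i>1$. Let $\mathcal U_n^{m}$ be Lagrange interpolation in the $m$ Clenshaw–Curtis nodes $-\cos\frac{\pi(j-1)}{m-1}$, $1\le j\le m$ (the node $0$ if $m=1$), transported affinely from $[-1,1]$ to $\Gamma_n$, and $\mathcal U_n^0=0$. For $\bm i\in\mathbb{N}^N$ put $\Delta^{m(\bm i)}=\bigotimes_{n=1}^N(\mathcal U_n^{m(i_n)}-\mathcal U_n^{m(i_n-1)})$, $\Lambda_{\bm i}=\prod_n i_n$ and $|m(\bm i-\bm 1)|_1=\sum_n m(i_n-1)$. For a finite set $I\subset\mathbb{N}^N$ let $S_I=\sum_{\bm i\in I}\Delta^{m(\bm i)}$, let $\mathcal M_I=\{\bm i\in\mathbb{N}^N:\bm i-\bm e_n\in I\text{ for some }n\text{ with }i_n>1\}$, and for $u:\Gamma\to V$ let $$\zeta_{\bm i,I}=\big\|\Delta^{m(\bm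 i)}(a\nabla S_I[u])\big\|_{L^\infty(\Gamma,L^2(D))},\qquad \zeta_{SC,I}=\sum_{\bm i\in\mathcal M_I}\zeta_{\bm i,I}.$$ **Adaptive algorithm.** Put $I_0=\{\bm 1\}$. Given $I_\ell$, let $\bm i_\ell$ maximize a profit $\mathcal P_{\bm i,I_\ell}$ over $\bm i\in\mathcal M_{I_\ell}\setminus I_\ell$ (ties: the lexicographically first maximizer) and put $I_{\ell+1}=I_\ell\cup A_{\bm i_\ell,I_\ell}$, where $A_{\bm i,I}=\{\bm j\in\mathbb{N}^N:\bm j\le\bm i\}\setminus I$ is the smallest subset of $\mathcal M_I$ containing $\bm i$ such that $I\cup A_{\bm i,I}$ is downward-closed. The profit is either $\mathcal P_{\bm i,I}=\sum_{\bm j\in A_{\bm i,I}}\zeta_{\bm j,I}$ or $\mathcal P_{\bm i,I}=\sum_{\bm j\in A_{\bm i,I}}\zeta_{\bm j,I}\big/\sum_{\bm j\in A_{\bm i,I}}W_{\bm j}$ with $W_{\bm j}=\prod_n(m(j_n)-m(j_n-1))$. **Proposition.** There are constants $C,B>0$, depending only on the data $\Gamma,\bm\tau,\rho,D,a$ (including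 $N$), such that the following holds for every $u:\Gamma\to V$ which extends to a holomorphic function $u:\Sigma(\Gamma,\bm\tau)\to H^1_0(D;\mathbb{C})$ (holomorphic in a neighbourhood of every point of $\Sigma(\Gamma,\bm\tau)$) with $\|u(\bm z)\|_V\le M$ on $\Sigma(\Gamma,\bm\tau)$. 1. For every finite multi-index set $I\subset\mathbb{N}^N$ and every $\bm i\in\mathcal M_I$, $$\zeta_{\bm i,I}\le C\,M\,N\,\Lambda_{\bm i}^2\,e^{-\sigma|m(\bm i-\bm 1)|_1}.$$ 2. For every finite multi-index set $I\subset\mathbb{N}^N$, $\zeta_{SC,I}\le B\,M$. In particular, for either choice of the profit, $\zeta_{SC,I_\ell}\le B\,M$ for all $\ell\ge0$ along the adaptive algorithm. -/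

import Mathlib

open MeasureTheory Set
open scoped ENNReal NNReal ContDiff

noncomputable section

namespace SparseGrid

/-! ## The Sobolev space `H¹₀(D)` -/

section Sobolev

/-- Lebesgue measure on the spatial domain `D ⊆ ℝᵈ`. -/
abbrev domainMeasure {d : ℕ} (D : Set (EuclideanSpace ℝ (Fin d))) :
    Measure (EuclideanSpace ℝ (Fin d)) := volume.restrict D

variable (𝕜 : Type) [RCLike 𝕜] {d : ℕ} (D : Set (EuclideanSpace ℝ (Fin d)))

/-- Pairs (value, gradient) in `L²(D; 𝕜) × L²(D; 𝕜ᵈ)`, with the `H¹` Hilbert norm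
`(‖v‖² + ‖g‖²)^{1/2}`. -/
abbrev GraphSpace : Type :=
  WithLp 2 (Lp 𝕜 2 (domainMeasure D) × Lp (EuclideanSpace 𝕜 (Fin d)) 2 (domainMeasure D))

/-- The classical gradient of a function `ℝᵈ → 𝕜`. -/
def classicalGrad {𝕜 : Type} [RCLike 𝕜] {d : ℕ} (φ : EuclideanSpace ℝ (Fin d) → 𝕜)
    (x : EuclideanSpace ℝ (Fin d)) : EuclideanSpace 𝕜 (Fin d) :=
  WithLp.toLp 2 fun k => fderiv ℝ φ x (EuclideanSpace.single k 1)

/-- The pairs `(φ, ∇φ)` with `φ ∈ C_c^∞(D)`. -/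
def testPairs : Set (GraphSpace 𝕜 D) :=
  {p | ∃ φ : EuclideanSpace ℝ (Fin d) → 𝕜,
    ContDiff ℝ ∞ φ ∧ HasCompactSupport φ ∧ tsupport φ ⊆ D ∧
    (p.fst : EuclideanSpace ℝ (Fin d) → 𝕜) =ᵐ[domainMeasure D] φ ∧
    (p.snd : EuclideanSpace ℝ (Fin d) → EuclideanSpace 𝕜 (Fin d))
      =ᵐ[domainMeasure D] classicalGrad φ}

/-- `H¹₀(D; 𝕜)`: the closure of `C_c^∞(D; 𝕜)` in the `H¹` norm. A function is recorded together
with its weak gradient. -/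
abbrev H10 : Type := ↥((Submodule.span 𝕜 (testPairs 𝕜 D)).topologicalClosure)

variable {𝕜 D}

/-- The function underlying an element of `H¹₀(D)`. -/
def H10.value (v : H10 𝕜 D) : Lp 𝕜 2 (domainMeasure D) := v.1.fst

/-- The weak gradient of an element of `H¹₀(D)`; `‖v‖_V = ‖v.grad‖`. -/
def H10.grad (v : H10 𝕜 D) : Lp (EuclideanSpace 𝕜 (Fin d)) 2 (domainMeasure D) := v.1.snd

end Sobolev

/-! ## One-dimensional Lagrange interpolation in Clenshaw–Curtis nodes -/

/-- The doubling rule: `m(0) = 0`, `m(1) = 1`, `m(i) = 2^(i-1) + 1` for `i > 1`. -/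
def doubling (i : ℕ) : ℕ := if i = 0 then 0 else if i = 1 then 1 else 2 ^ (i - 1) + 1

/-- The `j`-th (`j = 0, …, m - 1`) of the `m` Clenshaw–Curtis nodes of `[-1, 1]`; for `m = 1` the
only node is the midpoint. -/
def ccNode (m j : ℕ) : ℝ :=
  if m = 1 then 0 else -Real.cos (Real.pi * (j : ℝ) / ((m : ℝ) - 1))

/-- Clenshaw–Curtis nodes transported affinely from `[-1, 1]` to `[lo, hi]`. -/
def node (lo hi : ℝ) (m j : ℕ) : ℝ := (lo + hi) / 2 + (hi - lo) / 2 * ccNode m j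

section Operators

variable {X : Type*} [AddCommGroup X] [Module ℝ X]

/-- The Lagrange interpolant `𝒰^m v` in the `m` Clenshaw–Curtis nodes of `[lo, hi]`;
it is `0` for `m = 0`. -/
def lagrangeInterp (lo hi : ℝ) (m : ℕ) (v : ℝ → X) (t : ℝ) : X :=
  ∑ j : Fin m, (Lagrange.basis Finset.univ (fun k : Fin m => node lo hi m k) j).eval t •
    v (node lo hi m j)

/-- The detail operator `Δ^{m(i)} = 𝒰^{m(i)} - 𝒰^{m(i-1)}`, for `i ≥ 1`. -/
def detail (lo hi : ℝ) (i : ℕ) (v : ℝ → X) (t : ℝ) : X :=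
  lagrangeInterp lo hi (doubling i) v t - lagrangeInterp lo hi (doubling (i - 1)) v t

/-- A one-dimensional operator acting on the `n`-th variable, the others being frozen. -/
def onCoord {N : ℕ} (T : (ℝ → X) → ℝ → X) (n : Fin N) (F : (Fin N → ℝ) → X) :
    (Fin N → ℝ) → X :=
  fun y => T (fun t => F (Function.update y n t)) (y n)

/-- The hierarchical surplus `Δ^{m(i)} = ⨂ₙ Δ^{m(iₙ)}`: the detail operators are applied in each
variable, one after the other. -/
def surplus {N : ℕ} (lo hi : Fin N → ℝ) (i : Fin N → ℕ) (F : (Fin N → ℝ) → X) :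
    (Fin N → ℝ) → X :=
  (List.finRange N).foldr (fun n G => onCoord (detail (lo n) (hi n) (i n)) n G) F

/-- The sparse grid interpolant `S_I[v] = ∑_{i ∈ I} Δ^{m(i)} v`. -/
def sparseInterp {N : ℕ} (lo hi : Fin N → ℝ) (I : Finset (Fin N → ℕ)) (v : (Fin N → ℝ) → X)
    (y : Fin N → ℝ) : X :=
  ∑ i ∈ I, surplus lo hi i v y

end Operators

/-! ## Multi-indices -/

section Indices

variable {N : ℕ}

/-- `I ⊆ ℕᴺ`, where `ℕ = {1, 2, …}`. -/
def IsIndexSet (I : Finset (Fin N → ℕ)) : Prop := ∀ i ∈ I, ∀ n, 1 ≤ i n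

/-- Downward-closed multi-index sets. -/
def DownwardClosed (I : Finset (Fin N → ℕ)) : Prop :=
  ∀ i ∈ I, ∀ n, 1 < i n → i - Pi.single n 1 ∈ I

/-- The margin `𝓜_I`. -/
def margin (I : Finset (Fin N → ℕ)) : Set (Fin N → ℕ) :=
  {i | (∀ n, 1 ≤ i n) ∧ ∃ n, 1 < i n ∧ i - Pi.single n 1 ∈ I}

/-- `A_{i,I}`, the indices to be added to `I` when `i` is selected: the rectangle `{j : 1 ≤ j ≤ i}`
without `I`. By `isLeast_enrichment` it is the smallest subset `A ∋ i` of the margin such that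
`I ∪ A` is downward-closed. -/
def enrichment (i : Fin N → ℕ) (I : Finset (Fin N → ℕ)) : Finset (Fin N → ℕ) :=
  Finset.Icc (fun _ => 1) i \ I

lemma sub_single_apply (i : Fin N → ℕ) (n k : Fin N) :
    (i - Pi.single n 1 : Fin N → ℕ) k = if k = n then i k - 1 else i k := by
  by_cases h : k = n
  · subst h; simp
  · simp [h]

lemma DownwardClosed.mem_of_le {I : Finset (Fin N → ℕ)} (hI : DownwardClosed I) :
    ∀ (s : ℕ) (j i : Fin N → ℕ), ∑ n, i n = s → i ∈ I → (∀ n, 1 ≤ j n) → j ≤ i → j ∈ I := by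
  intro s
  induction s using Nat.strong_induction_on with
  | _ s ih =>
    intro j i hs hi h1 hji
    by_cases hEq : j = i
    · exact hEq ▸ hi
    · obtain ⟨n, hn⟩ : ∃ n, j n < i n := by
        by_contra hcon
        push Not at hcon
        exact hEq (le_antisymm hji hcon)
      have h1n := h1 n
      have hle : j ≤ i - Pi.single n 1 := by
        intro k
        have := hji k
        rw [sub_single_apply]
        split_ifs with hk
        · subst hk; change j k ≤ i k - 1; omega
        · exact this
      have hlt : ∑ k, (i - Pi.single n 1 : Fin N → ℕ) k < s := by
        rw [← hs]
        refine Finset.sum_lt_sum (fun k _ => ?_) ⟨n, Finset.mem_univ n, ?_⟩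
        · rw [sub_single_apply]; split_ifs <;> omega
        · rw [sub_single_apply, if_pos rfl]; omega
      exact ih _ hlt j _ rfl (hI i hi n (by omega)) h1 hle

lemma isLeast_enrichment {I : Finset (Fin N → ℕ)} (hI : DownwardClosed I) {i : Fin N → ℕ}
    (hi : i ∈ margin I) (hiI : i ∉ I) :
    IsLeast {A : Finset (Fin N → ℕ) | (A : Set (Fin N → ℕ)) ⊆ margin I ∧ i ∈ A ∧
      DownwardClosed (I ∪ A)} (enrichment i I) := by
  obtain ⟨hpos, n, hn, hmem⟩ := hi
  refine ⟨⟨?_, ?_, ?_⟩, ?_⟩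
  · intro j hj
    simp only [enrichment, Finset.mem_coe, Finset.mem_sdiff, Finset.mem_Icc] at hj
    obtain ⟨⟨h1, hji⟩, hjI⟩ := hj
    have h1 : ∀ p, 1 ≤ j p := h1
    have key : ∀ k : Fin N → ℕ, (∀ p, 1 ≤ k p) → k ≤ i - Pi.single n 1 → k ∈ I :=
      fun k hk hle => hI.mem_of_le _ k _ rfl hmem hk hle
    have hjn : j n = i n := by
      by_contra hne
      refine hjI (key j h1 fun k => ?_)
      have : j k ≤ i k := hji k
      rw [sub_single_apply]
      split_ifs with hk
      · change j k ≤ i k - 1; rw [hk] at this ⊢; omega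
      · exact this
    refine ⟨h1, n, by omega, key _ (fun p => ?_) (fun p => ?_)⟩
    · have := h1 p
      rw [sub_single_apply]
      split_ifs with hp
      · subst hp; omega
      · exact this
    · have := hji p
      rw [sub_single_apply, sub_single_apply]
      split_ifs
      · exact Nat.sub_le_sub_right this 1
      · exact this
  · simp only [enrichment, Finset.mem_sdiff, Finset.mem_Icc]
    exact ⟨⟨fun p => hpos p, le_rfl⟩, hiI⟩
  · intro j hj p hp
    rcases Finset.mem_union.1 hj with h | h
    · exact Finset.mem_union_left _ (hI j h p hp)
    · simp only [enrichment, Finset.mem_sdiff, Finset.mem_Icc] at h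
      simp only [enrichment, Finset.mem_union, Finset.mem_sdiff, Finset.mem_Icc]
      by_cases hk : j - Pi.single p 1 ∈ I
      · exact Or.inl hk
      · refine Or.inr ⟨⟨fun q => ?_, fun q => ?_⟩, hk⟩
        · have : 1 ≤ j q := h.1.1 q
          rw [sub_single_apply]
          split_ifs with hq
          · subst hq; change 1 ≤ j q - 1; omega
          · exact this
        · have : j q ≤ i q := h.1.2 q
          rw [sub_single_apply]
          split_ifs
          · change j q - 1 ≤ i q; omega
          · exact this
  · rintro B ⟨-, hiB, hB⟩ j hj
    simp only [enrichment, Finset.mem_sdiff, Finset.mem_Icc] at hj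
    have := hB.mem_of_le _ j i rfl (Finset.mem_union_right _ hiB) (fun p => hj.1.1 p) hj.1.2
    exact (Finset.mem_union.1 this).resolve_left hj.2

/-- `Λ_i = ∏ₙ iₙ`. -/
def Lam (i : Fin N → ℕ) : ℕ := ∏ n, i n

/-- `|m(i - 1)|₁ = ∑ₙ m(iₙ - 1)`. -/
def shiftedLevel (i : Fin N → ℕ) : ℕ := ∑ n, doubling (i n - 1)

/-- The work `W_j = ∏ₙ (m(jₙ) - m(jₙ - 1))`. -/
def work (j : Fin N → ℕ) : ℕ := ∏ n, (doubling (j n) - doubling (j n - 1))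

end Indices

/-! ## The parameter domain and the diffusion coefficient -/

section Parameters

variable {N : ℕ}

/-- `Σ(Γ, τ) = {z ∈ ℂᴺ : dist(zₙ, Γₙ) ≤ τₙ for all n}`, where `Γₙ = [loₙ, hiₙ]`. -/
def Sig (lo hi τ : Fin N → ℝ) : Set (Fin N → ℂ) :=
  {z | ∀ n, Metric.infDist (z n) (Complex.ofReal '' Icc (lo n) (hi n)) ≤ τ n}

/-- `σ = minₙ log(2τₙ/|Γₙ| + √(1 + 4τₙ²/|Γₙ|²))`. -/
def rate (lo hi τ : Fin N → ℝ) : ℝ :=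
  ⨅ n, Real.log (2 * τ n / (hi n - lo n) + Real.sqrt (1 + 4 * τ n ^ 2 / (hi n - lo n) ^ 2))

/-- The law `ρ(y) dy` on `Γ`, where `ρ = ⨂ₙ ρₙ`. -/
def paramLaw (lo hi : Fin N → ℝ) (ρ : Fin N → ℝ → ℝ≥0) : Measure (Fin N → ℝ) :=
  Measure.pi fun n => (volume.restrict (Icc (lo n) (hi n))).withDensity fun t => (ρ n t : ℝ≥0∞)

/-- The diffusion coefficient `a(y, x) = a₀(x) + ∑ₙ aₙ(x) yₙ`. -/
def coeff {d : ℕ} (a₀ : EuclideanSpace ℝ (Fin d) → ℝ) (a : Fin N → EuclideanSpace ℝ (Fin d) → ℝ)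
    (y : Fin N → ℝ) (x : EuclideanSpace ℝ (Fin d)) : ℝ :=
  a₀ x + ∑ n, a n x * y n

end Parameters

/-! ## Estimators and the adaptive algorithm -/

section Algorithm

variable {N d : ℕ} {D : Set (EuclideanSpace ℝ (Fin d))} (lo hi : Fin N → ℝ)
  (a₀ : EuclideanSpace ℝ (Fin d) → ℝ) (a : Fin N → EuclideanSpace ℝ (Fin d) → ℝ)
  (u : (Fin N → ℝ) → H10 ℝ D)

/-- The flux `a ∇ S_I[u]`, as a function of `y` and `x`. -/
def flux (I : Finset (Fin N → ℕ)) (y : Fin N → ℝ) (x : EuclideanSpace ℝ (Fin d)) :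
    EuclideanSpace ℝ (Fin d) :=
  coeff a₀ a y x • (sparseInterp lo hi I u y).grad x

/-- The pointwise estimator `ζ_{i,I} = ‖Δ^{m(i)}(a ∇ S_I[u])‖_{L^∞(Γ, L²(D))}`. -/
def zeta (i : Fin N → ℕ) (I : Finset (Fin N → ℕ)) : ℝ≥0∞ :=
  essSup (fun y => eLpNorm (surplus lo hi i (flux lo hi a₀ a u I) y) 2 (domainMeasure D))
    (volume.restrict (Icc lo hi))

/-- The parametric estimator `ζ_{SC,I} = ∑_{i ∈ 𝓜_I} ζ_{i,I}` (a finite sum). -/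
def zetaSC (I : Finset (Fin N → ℕ)) : ℝ≥0∞ := ∑' i : margin I, zeta lo hi a₀ a u i I

/-- The workless profit. -/
def worklessProfit (i : Fin N → ℕ) (I : Finset (Fin N → ℕ)) : ℝ≥0∞ :=
  ∑ j ∈ enrichment i I, zeta lo hi a₀ a u j I

/-- The profit with work. -/
def profitWithWork (i : Fin N → ℕ) (I : Finset (Fin N → ℕ)) : ℝ≥0∞ :=
  (∑ j ∈ enrichment i I, zeta lo hi a₀ a u j I) / ∑ j ∈ enrichment i I, (work j : ℝ≥0∞)

/-- `i` maximizes the profit `P` over the indices of the margin which are not yet in `I`, and it is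
the first maximizer in the lexicographic ordering. -/
def IsProfitMaximizer (P : (Fin N → ℕ) → Finset (Fin N → ℕ) → ℝ≥0∞)
    (I : Finset (Fin N → ℕ)) (i : Fin N → ℕ) : Prop :=
  i ∈ margin I ∧ i ∉ I ∧ ∀ j ∈ margin I, j ∉ I →
    P j I ≤ P i I ∧ (P j I = P i I → toLex i ≤ toLex j)

/-- The multi-index sets `I₀, I₁, …` produced by the adaptive algorithm driven by the profit `P`
(never stopped): `I₀ = {1}` and `I_{ℓ+1} = I_ℓ ∪ A_{i_ℓ, I_ℓ}`, with `i_ℓ` the profit maximizer. -/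
def IsAdaptiveRun (P : (Fin N → ℕ) → Finset (Fin N → ℕ) → ℝ≥0∞)
    (I : ℕ → Finset (Fin N → ℕ)) : Prop :=
  I 0 = {fun _ => 1} ∧
    ∀ ℓ, ∃ i, IsProfitMaximizer P (I ℓ) i ∧ I (ℓ + 1) = I ℓ ∪ enrichment i (I ℓ)

end Algorithm

end SparseGrid

end

open SparseGrid

/-! The coefficient is affine in `y`, so the surplus of the flux is `a₀` times the surplus of
`∇S_I[u]` plus the sum of `aₙ` times the surplus of `yₙ ∇S_I[u]` (`surplus_flux_ae_eq`). Expand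
`S_I` in surpluses `Δ^{m(j)}`. The nodes are nested and interpolation reproduces polynomials, so in
one variable `Δ_i Δ_j = 0` for `j ≠ i`. Multiplication by `t` raises the degree by one only, so `Δ_i
(t Δ_j) = 0` unless `j` is `i` or `i - 1`. Hence at most `1 + 2N` terms survive, however large `I`
is.

Each surviving term is a tensor product of one-dimensional operators, each a difference of two
approximations of the same holomorphic function (`f` or `t f`) that use at least `m(i - 1)` nodes.
The Joukowski map turns `f (cos θ)` into a cosine series with geometric decay
(`hasSum_cos_of_differentiableAt`). On Clenshaw–Curtis nodes every cosine aliases to a cosine of low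
frequency, so interpolated cosines stay bounded by `1` and no Lebesgue constant enters. This gives
`norm_sub_lagrangeInterp_le`, and `norm_tensorOp_le` multiplies the one-dimensional bounds to obtain
the decay `exp (-σ |m(i - 1)|₁)`.

Two facts link this to the estimators. The coefficients `a₀, aₙ` are bounded on `D`, by comparing
two admissible parameters that differ in one coordinate. The gradient of the complex extension
restricts to the gradient of `u` on `Γ`, because weak gradients are determined by the function.
Finally the bound on `ζ_{i,I}` factorizes over coordinates, so its sum over any set of indices is at
most the `N`-th power of a convergent one-dimensional series. -/

namespace SparseGrid

/-! ### Cosine series of functions holomorphic near `[-1, 1]`. -/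

section Chebyshev

open Complex Metric

variable {E : Type*} [NormedAddCommGroup E] [NormedSpace ℂ E]

lemma inv_add_sqrt_one_add_sq (b : ℝ) : (b + √(1 + b ^ 2))⁻¹ = √(1 + b ^ 2) - b := by
  refine inv_eq_of_mul_eq_one_right ?_
  have := Real.sq_sqrt (show 0 ≤ 1 + b ^ 2 by positivity)
  linear_combination this

lemma one_lt_add_sqrt {b : ℝ} (hb : 0 < b) : 1 < b + √(1 + b ^ 2) := by
  have : 1 ≤ √(1 + b ^ 2) := Real.one_le_sqrt.2 (by nlinarith)
  linarith

/-- The closed annulus `ϱ⁻¹ ≤ |w| ≤ ϱ` is mapped by the Joukowski map into the closed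
`b`-neighbourhood of `[-1, 1]`, where `ϱ = b + √(1 + b²)`. -/
lemma infDist_joukowski_le {b : ℝ} (hb : 0 < b) {w : ℂ} (h1 : (b + √(1 + b ^ 2))⁻¹ ≤ ‖w‖)
    (h2 : ‖w‖ ≤ b + √(1 + b ^ 2)) :
    infDist ((w + w⁻¹) / 2) (ofReal '' Icc (-1) 1) ≤ b := by
  have hpos : 0 < b + √(1 + b ^ 2) := by positivity
  have hr : 0 < ‖w‖ := (inv_pos.2 hpos).trans_le h1
  have h3 : ‖w‖⁻¹ ≤ b + √(1 + b ^ 2) := (inv_le_comm₀ hpos hr).1 h1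
  have h4 : (b + √(1 + b ^ 2))⁻¹ ≤ ‖w‖⁻¹ := inv_anti₀ hr h2
  rw [inv_add_sqrt_one_add_sq] at h1 h4
  set r := ‖w‖ with hrdef
  set t := r⁻¹ with ht
  have hrt : r * t = 1 := mul_inv_cancel₀ hr.ne'
  have hsq : w.re ^ 2 + w.im ^ 2 = r ^ 2 := by
    rw [hrdef, ← Complex.normSq_eq_norm_sq, Complex.normSq_apply]; ring
  have hre : (w⁻¹).re = w.re * t ^ 2 := by
    rw [Complex.inv_re, Complex.normSq_eq_norm_sq, div_eq_mul_inv, ht, inv_pow]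
  have him : (w⁻¹).im = -w.im * t ^ 2 := by
    rw [Complex.inv_im, Complex.normSq_eq_norm_sq, div_eq_mul_inv, ht, inv_pow]
  have hc : (w.re * t) ^ 2 + (w.im * t) ^ 2 = 1 := by
    calc _ = (w.re ^ 2 + w.im ^ 2) * t ^ 2 := by ring
      _ = (r * t) ^ 2 := by rw [hsq]; ring
      _ = 1 := by rw [hrt, one_pow]
  -- For `w = r e^{iα}` the comparison point is `cos α`. The offset has coordinates `cos α ((r +
  -- t)/2 - 1)` and `sin α (r - t)/2` with `t = 1/r`, and both amplitudes are at most `|r - t|/2 ≤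
  -- b`.
  have hmem : ((w.re * t : ℝ) : ℂ) ∈ ofReal '' Icc (-1) 1 := by
    refine mem_image_of_mem _ (abs_le.1 ?_)
    exact abs_le_one_iff_mul_self_le_one.2 (by nlinarith [sq_nonneg (w.im * t)])
  refine (infDist_le_dist_of_mem hmem).trans ?_
  rw [Complex.dist_eq]
  refine abs_le_of_sq_le_sq' ?_ hb.le |>.2
  rw [← Complex.normSq_eq_norm_sq, Complex.normSq_apply]
  have e1 : ((w + w⁻¹) / 2 - ((w.re * t : ℝ) : ℂ)).re = (w.re * t) * ((r + t) / 2 - 1) := by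
    simp only [sub_re, ofReal_re, div_ofNat_re, add_re, hre]
    linear_combination (-w.re / 2) * hrt
  have e2 : ((w + w⁻¹) / 2 - ((w.re * t : ℝ) : ℂ)).im = (w.im * t) * ((r - t) / 2) := by
    simp only [sub_im, ofReal_im, div_ofNat_im, add_im, him]
    linear_combination (-w.im / 2) * hrt
  rw [e1, e2]
  have k1 : ((r + t) / 2 - 1) ^ 2 ≤ ((r - t) / 2) ^ 2 := by
    have : 2 ≤ r + t := by nlinarith [sq_nonneg (r - t), inv_pos.2 hr]
    nlinarith
  have k2 : ((r - t) / 2) ^ 2 ≤ b ^ 2 := by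
    refine sq_le_sq' ?_ ?_ <;> linarith
  calc _ = (w.re * t) ^ 2 * ((r + t) / 2 - 1) ^ 2 + (w.im * t) ^ 2 * ((r - t) / 2) ^ 2 := by ring
    _ ≤ (w.re * t) ^ 2 * ((r - t) / 2) ^ 2 + (w.im * t) ^ 2 * ((r - t) / 2) ^ 2 := by gcongr
    _ = ((r - t) / 2) ^ 2 := by rw [← add_mul, hc, one_mul]
    _ ≤ b ^ 2 := k2

/-- Under `w ↦ w⁻¹` the differential gains the factor `-w⁻²` and the circle is traversed backwards;
the two signs cancel. -/
lemma circleIntegral_inv_radius (f : ℂ → E) {R : ℝ} (hR : 0 < R) :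
    (∮ w in C(0, R⁻¹), f w) = ∮ w in C(0, R), (w⁻¹ ^ 2) • f w⁻¹ := by
  have hinv : ∀ θ : ℝ, circleMap 0 R⁻¹ (2 * Real.pi - θ) = (circleMap 0 R θ)⁻¹ := by
    intro θ
    simp only [circleMap_zero]
    push_cast
    rw [mul_inv, ← Complex.exp_neg, sub_mul, Complex.exp_sub, Complex.exp_two_pi_mul_I,
      Complex.exp_neg, one_div]
  have key := intervalIntegral.integral_comp_sub_left (a := 0) (b := 2 * Real.pi)
    (fun θ => deriv (circleMap 0 R⁻¹) θ • f (circleMap 0 R⁻¹ θ)) (2 * Real.pi)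
  rw [sub_self, sub_zero] at key
  rw [circleIntegral, circleIntegral, ← key]
  refine intervalIntegral.integral_congr fun θ _ => ?_
  simp only [deriv_circleMap, hinv, smul_smul]
  have hne : circleMap 0 R θ ≠ 0 := circleMap_ne_center hR.ne'
  congr 1
  field_simp

/-- Cauchy's formula on an annulus, for a function with `g w⁻¹ = g w`. -/
lemma two_pi_I_smul_eq_circleIntegral [CompleteSpace E] {R : ℝ} (hR : 1 < R) {g : ℂ → E}
    (hg : ∀ w : ℂ, R⁻¹ ≤ ‖w‖ → ‖w‖ ≤ R → DifferentiableAt ℂ g w) (hinv : ∀ w, g w⁻¹ = g w)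
    {s : ℂ} (hs : ‖s‖ = 1) :
    (2 * Real.pi * I : ℂ) • g s = (∮ w in C(0, R), (w - s)⁻¹ • g w) +
      (∮ w in C(0, R), (w - s⁻¹)⁻¹ • g w) - ∮ w in C(0, R), w⁻¹ • g w := by
  have hR0 : 0 < R := by linarith
  have hRi : R⁻¹ < 1 := inv_lt_one_of_one_lt₀ hR
  have hRi0 : 0 < R⁻¹ := inv_pos.2 hR0
  have hs0 : s ≠ 0 := by rintro rfl; simp at hs
  have hgc : ∀ r, R⁻¹ ≤ r → r ≤ R → ContinuousOn g (sphere 0 r) := by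
    intro r h1 h2 w hw
    rw [mem_sphere_zero_iff_norm] at hw
    exact (hg w (by rwa [hw]) (by rwa [hw])).continuousAt.continuousWithinAt
  have hci : ∀ r, 0 ≤ r → R⁻¹ ≤ r → r ≤ R → ∀ a : ℂ, ‖a‖ ≠ r →
      CircleIntegrable (fun w => (w - a)⁻¹ • g w) 0 r := by
    intro r h0 h1 h2 a ha
    refine ContinuousOn.circleIntegrable h0 (ContinuousOn.smul ?_ (hgc r h1 h2))
    refine ContinuousOn.inv₀ (by fun_prop) fun w hw h => ha ?_
    rw [mem_sphere_zero_iff_norm] at hw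
    rw [← hw, sub_eq_zero.1 h]
  -- The singularity of the difference quotient at `s` is removable, so its integrals over the two
  -- boundary circles agree.
  have hann : (∮ w in C(0, R), dslope g s w) = ∮ w in C(0, R⁻¹), dslope g s w := by
    refine circleIntegral_eq_of_differentiable_on_annulus_off_countable hRi0 (by linarith)
      (countable_singleton s) ?_ ?_
    · intro w hw
      simp only [mem_sdiff, mem_closedBall_zero_iff, mem_ball_zero_iff, not_lt] at hw
      by_cases h : w = s
      · subst h
        exact (continuousAt_dslope_same.2 (hg w hw.2 hw.1)).continuousWithinAt
      · exact ((continuousAt_dslope_of_ne h).2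
          (hg w hw.2 hw.1).continuousAt).continuousWithinAt
    · intro w hw
      simp only [mem_sdiff, mem_closedBall_zero_iff, mem_ball_zero_iff, not_le,
        mem_singleton_iff] at hw
      exact (differentiableAt_dslope_of_ne hw.2).2 (hg w hw.1.2.le hw.1.1.le)
  have hsplit : ∀ r, 0 ≤ r → R⁻¹ ≤ r → r ≤ R → r ≠ 1 → (∮ w in C(0, r), dslope g s w) =
      (∮ w in C(0, r), (w - s)⁻¹ • g w) - (∮ w in C(0, r), (w - s)⁻¹) • g s := by
    intro r h0 h1 h2 h3
    have hsr : ‖s‖ ≠ r := by rw [hs]; exact h3.symm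
    rw [← circleIntegral.integral_smul_const, ← circleIntegral.integral_sub (hci r h0 h1 h2 s hsr)]
    · refine circleIntegral.integral_congr h0 fun w hw => ?_
      rw [mem_sphere_zero_iff_norm] at hw
      have hne : w ≠ s := by rintro rfl; exact hsr hw
      simp only [dslope_of_ne _ hne, slope_def_module, smul_sub]
    · refine ContinuousOn.circleIntegrable h0 (ContinuousOn.smul ?_ continuousOn_const)
      refine ContinuousOn.inv₀ (by fun_prop) fun w hw h => hsr ?_
      rw [mem_sphere_zero_iff_norm] at hw
      rw [← hw, sub_eq_zero.1 h]
  rw [hsplit R hR0.le (by linarith) le_rfl hR.ne', hsplit R⁻¹ hRi0.le le_rfl (by linarith) hRi.ne,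
    circleIntegral.integral_sub_inv_of_mem_ball (by rw [mem_ball_zero_iff, hs]; exact hR)] at hann
  have hzero : (∮ w in C(0, R⁻¹), (w - s)⁻¹) = 0 := by
    have hne : ∀ w ∈ closedBall (0 : ℂ) R⁻¹, w - s ≠ 0 := by
      intro w hw h
      rw [mem_closedBall_zero_iff, sub_eq_zero.1 h, hs] at hw
      linarith
    refine circleIntegral_eq_zero_of_differentiable_on_off_countable hRi0.le countable_empty
      (ContinuousOn.inv₀ (by fun_prop) hne) fun w hw => ?_
    exact DifferentiableAt.inv (by fun_prop) (hne w (ball_subset_closedBall hw.1))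
  have hsi : ‖s⁻¹‖ ≠ R := by rw [norm_inv, hs, inv_one]; exact hR.ne
  -- Inversion and the symmetry of `g` move the inner integral to the outer circle; the kernel
  -- becomes `w⁻² / (w⁻¹ - s) = w⁻¹ - (w - s⁻¹)⁻¹`.
  have hsub : (∮ w in C(0, R⁻¹), (w - s)⁻¹ • g w) =
      (∮ w in C(0, R), w⁻¹ • g w) - ∮ w in C(0, R), (w - s⁻¹)⁻¹ • g w := by
    have h0 := hci R hR0.le (by linarith) le_rfl 0 (by simpa using hR0.ne)
    simp only [sub_zero] at h0
    rw [circleIntegral_inv_radius _ hR0, ← circleIntegral.integral_sub h0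
      (hci R hR0.le (by linarith) le_rfl s⁻¹ hsi)]
    refine circleIntegral.integral_congr hR0.le fun w hw => ?_
    rw [mem_sphere_zero_iff_norm] at hw
    have hw0 : w ≠ 0 := by rintro rfl; simp at hw; linarith
    have hw1 : w - s⁻¹ ≠ 0 := fun h => hsi (by rw [← hw, sub_eq_zero.1 h])
    have hw2 : w⁻¹ - s ≠ 0 := by
      intro h
      apply hw1
      rw [← sub_eq_zero.1 h, inv_inv, sub_self]
    simp only [hinv, smul_smul, ← sub_smul]
    congr 1
    have hw4 : s * w - 1 ≠ 0 := by
      intro h; apply hw2; field_simp; linear_combination -h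
    have e1 : w⁻¹ - s = (1 - s * w) / w := by field_simp
    have e2 : w - s⁻¹ = (s * w - 1) / s := by field_simp
    rw [e1, e2, inv_div, inv_div, show 1 - s * w = -(s * w - 1) by ring, div_neg]
    clear e1 e2
    generalize hk : s * w - 1 = k at hw4
    field_simp
    linear_combination hk
  rw [hzero, zero_smul, sub_zero, hsub] at hann
  rw [sub_eq_iff_eq_add, add_comm, ← sub_eq_iff_eq_add] at hann
  rw [← hann]
  abel

/-- The function `g w = f ((w + w⁻¹)/2)` is symmetric under inversion. The three integrals in its
Cauchy formula are values, at `s`, `s⁻¹` and `0`, of one power series with coefficients `c k`, and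
`s = e^{iθ}` turns `s ^ k + s⁻¹ ^ k` into `2 cos kθ`. -/
lemma hasSum_cos_of_differentiableAt [CompleteSpace E] {b M : ℝ} (hb : 0 < b) {f : ℂ → E}
    (hd : ∀ z, infDist z (ofReal '' Icc (-1) 1) ≤ b → DifferentiableAt ℂ f z)
    (hM : ∀ z, infDist z (ofReal '' Icc (-1) 1) ≤ b → ‖f z‖ ≤ M) :
    ∃ A : ℕ → E, (∀ k, ‖A k‖ ≤ 2 * M * (b + √(1 + b ^ 2))⁻¹ ^ k) ∧
      ∀ θ : ℝ, HasSum (fun k : ℕ => ((Real.cos (k * θ) : ℝ) : ℂ) • A k)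
        (f ((Real.cos θ : ℝ) : ℂ)) := by
  set R := b + √(1 + b ^ 2) with hRdef
  have hR : 1 < R := one_lt_add_sqrt hb
  have hR0 : 0 < R := by linarith
  have hRi : R⁻¹ < 1 := inv_lt_one_of_one_lt₀ hR
  set g : ℂ → E := fun w => f ((w + w⁻¹) / 2) with hg
  have hgd : ∀ w : ℂ, R⁻¹ ≤ ‖w‖ → ‖w‖ ≤ R → DifferentiableAt ℂ g w := by
    intro w h1 h2
    have hw : w ≠ 0 := by rintro rfl; simp at h1; linarith
    refine DifferentiableAt.comp w (hd _ (infDist_joukowski_le hb h1 h2)) ?_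
    exact (differentiableAt_id.add (differentiableAt_inv hw)).div_const 2
  have hgM : ∀ w : ℂ, R⁻¹ ≤ ‖w‖ → ‖w‖ ≤ R → ‖g w‖ ≤ M :=
    fun w h1 h2 => hM _ (infDist_joukowski_le hb h1 h2)
  have hM0 : 0 ≤ M := (norm_nonneg _).trans (hgM 1 (by simpa using hRi.le) (by simpa using hR.le))
  set c : ℕ → E := fun k => (2 * Real.pi * I : ℂ)⁻¹ • ∮ w in C(0, R), (w⁻¹ ^ (k + 1)) • g w with hc
  have hcn : ∀ k, ‖c k‖ ≤ M * R⁻¹ ^ k := by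
    intro k
    refine (circleIntegral.norm_two_pi_i_inv_smul_integral_le_of_norm_le_const hR0.le
      (C := R⁻¹ ^ (k + 1) * M) fun w hw => ?_).trans_eq ?_
    · rw [mem_sphere_zero_iff_norm] at hw
      rw [norm_smul, norm_pow, norm_inv, hw]
      gcongr
      exact hgM w (by rw [hw]; linarith) hw.le
    · rw [pow_succ]; field_simp
  have hgcont : ContinuousOn g (sphere 0 R) := by
    intro w hw
    rw [mem_sphere_zero_iff_norm] at hw
    exact (hgd w (by linarith) hw.le).continuousAt.continuousWithinAt
  have hpi : (2 * Real.pi * I : ℂ) ≠ 0 := two_pi_I_ne_zero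
  have hsum : ∀ s : ℂ, ‖s‖ < R → HasSum (fun k => s ^ k • c k)
      ((2 * Real.pi * I : ℂ)⁻¹ • ∮ w in C(0, R), (w - s)⁻¹ • g w) := by
    intro s hs
    have h := (hasSum_two_pi_I_cauchyPowerSeries_integral
      (hgcont.circleIntegrable hR0.le) hs).const_smul (2 * Real.pi * I : ℂ)⁻¹
    simp only [zero_add, sub_zero] at h
    convert h using 2 with k
    rw [hc, smul_comm, ← circleIntegral.integral_smul]
    congr 1
    refine circleIntegral.integral_congr hR0.le fun w hw => ?_
    simp only [smul_smul]
    congr 1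
    rw [div_pow, pow_succ, inv_pow]
    ring
  -- The value at `0` is subtracted, which removes one of the two copies of `c 0`; hence no factor
  -- `2` there.
  refine ⟨fun k => if k = 0 then c 0 else (2 : ℂ) • c k, fun k => ?_, fun θ => ?_⟩
  · have := hcn k
    have h2 : 0 ≤ M * R⁻¹ ^ k := by positivity
    dsimp only
    split_ifs with h
    · subst h; linarith
    · rw [norm_smul, Complex.norm_ofNat]; linarith
  · set s : ℂ := Complex.exp (θ * I) with hs
    have hs1 : ‖s‖ = 1 := Complex.norm_exp_ofReal_mul_I θ
    have hsi : s⁻¹ = Complex.exp (-(θ * I)) := (Complex.exp_neg _).symm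
    have hgs : g s = f ((Real.cos θ : ℝ) : ℂ) := by
      change f ((s + s⁻¹) / 2) = _
      rw [hsi, hs, Complex.ofReal_cos, Complex.cos, neg_mul]
    have hfin := ((hsum s (by rw [hs1]; exact hR)).add
      (hsum s⁻¹ (by rw [norm_inv, hs1, inv_one]; exact hR))).sub (hsum 0 (by simpa using hR0))
    have hmain := two_pi_I_smul_eq_circleIntegral hR hgd
      (fun w => by simp only [hg, inv_inv, add_comm]) hs1
    rw [← smul_add, ← smul_sub] at hfin
    simp only [sub_zero] at hfin
    rw [← hmain, smul_smul, inv_mul_cancel₀ hpi, one_smul, hgs] at hfin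
    convert hfin using 2 with k
    rw [← add_smul, ← sub_smul]
    by_cases hk : k = 0
    · subst hk; simp
    · dsimp only
      rw [if_neg hk, zero_pow hk, sub_zero, smul_smul]
      congr 1
      rw [hsi, hs, ← Complex.exp_nat_mul, ← Complex.exp_nat_mul, Complex.ofReal_cos, Complex.cos]
      push_cast
      ring_nf

end Chebyshev

/-! ### Distinct and nested Clenshaw–Curtis nodes. -/

section Nodes

lemma doubling_add_two (i : ℕ) : doubling (i + 2) = 2 ^ (i + 1) + 1 := by
  simp [doubling]

lemma doubling_strictMono : StrictMono doubling := by
  refine strictMono_nat_of_lt_succ fun i => ?_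
  match i with
  | 0 => simp [doubling]
  | 1 => simp [doubling]
  | i + 2 =>
    rw [show i + 2 + 1 = (i + 1) + 2 from rfl, doubling_add_two, doubling_add_two]
    have : 0 < 2 ^ (i + 1) := by positivity
    rw [pow_succ 2 (i + 1)]
    omega

lemma ccNode_injective (m : ℕ) : Function.Injective fun j : Fin m => ccNode m j := by
  intro j k h
  by_cases hm : m = 1
  · subst hm; exact Subsingleton.elim j k
  have hm2 : 2 ≤ m := by have := j.2; omega
  have hm1 : (0 : ℝ) < (m : ℝ) - 1 := by
    have : (2 : ℝ) ≤ m := by exact_mod_cast hm2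
    linarith
  have hmem : ∀ l : Fin m, Real.pi * (l : ℝ) / ((m : ℝ) - 1) ∈ Icc 0 Real.pi := by
    intro l
    have hl : (l : ℝ) ≤ (m : ℝ) - 1 := by
      rw [le_sub_iff_add_le]; exact_mod_cast l.2
    refine ⟨by positivity, ?_⟩
    rw [div_le_iff₀ hm1]
    exact mul_le_mul_of_nonneg_left hl Real.pi_pos.le
  simp only [ccNode, if_neg hm, neg_inj] at h
  have h2 := Real.injOn_cos (hmem j) (hmem k) h
  rw [div_left_inj' hm1.ne', mul_right_inj' Real.pi_ne_zero] at h2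
  exact Fin.ext (by exact_mod_cast h2)

variable {lo hi : ℝ}

lemma node_injective (h : lo < hi) (m : ℕ) : Function.Injective fun j : Fin m => node lo hi m j := by
  intro j k hjk
  refine ccNode_injective m ?_
  have : (hi - lo) / 2 ≠ 0 := by linarith
  exact mul_left_cancel₀ this (add_left_cancel hjk)

lemma node_mem_Icc (h : lo ≤ hi) (m j : ℕ) : node lo hi m j ∈ Icc lo hi := by
  have : ccNode m j ∈ Icc (-1) 1 := by
    unfold ccNode
    split_ifs
    · simp
    · exact ⟨neg_le_neg (Real.cos_le_one _), neg_le.1 (Real.neg_one_le_cos _)⟩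
  constructor <;> unfold node <;> nlinarith [this.1, this.2]

/-- Doubling halves the angular step, so node `k` reappears as node `2k`. The single midpoint of
level `1` is the middle one of the three nodes of level `2`. -/
lemma exists_ccNode_succ_eq (i k : ℕ) (hk : k < doubling i) :
    ∃ k' < doubling (i + 1), ccNode (doubling (i + 1)) k' = ccNode (doubling i) k := by
  match i with
  | 0 => simp [doubling] at hk
  | 1 =>
    refine ⟨1, by simp [doubling], ?_⟩
    norm_num [doubling, ccNode]
  | i + 2 =>
    rw [doubling_add_two] at hk
    rw [show i + 2 + 1 = (i + 1) + 2 from rfl, doubling_add_two, doubling_add_two]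
    have h1 : 0 < 2 ^ (i + 1) := by positivity
    refine ⟨2 * k, by rw [pow_succ 2 (i + 1)]; omega, ?_⟩
    rw [ccNode, ccNode, if_neg (by rw [pow_succ]; omega), if_neg (by omega)]
    push_cast
    rw [add_sub_cancel_right, add_sub_cancel_right, pow_succ (2 : ℝ) (i + 1)]
    congr 2
    field_simp

lemma exists_node_eq {i j : ℕ} (hij : i ≤ j) (k : ℕ) (hk : k < doubling i) :
    ∃ k' < doubling j, node lo hi (doubling j) k' = node lo hi (doubling i) k := by
  suffices ∃ k' < doubling j, ccNode (doubling j) k' = ccNode (doubling i) k by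
    obtain ⟨k', h1, h2⟩ := this
    exact ⟨k', h1, by rw [node, node, h2]⟩
  induction j, hij using Nat.le_induction with
  | base => exact ⟨k, hk, rfl⟩
  | succ j _ ih =>
    obtain ⟨k', h1, h2⟩ := ih
    obtain ⟨k'', h3, h4⟩ := exists_ccNode_succ_eq j k' h1
    exact ⟨k'', h3, h4.trans h2⟩

end Nodes

/-! ### Algebra of the one-dimensional interpolation and detail operators. -/

section Interpolation

variable {X : Type*} [AddCommGroup X] [Module ℝ X] {lo hi : ℝ}

lemma lagrangeInterp_congr {m : ℕ} {v v' : ℝ → X}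
    (h : ∀ j : Fin m, v (node lo hi m j) = v' (node lo hi m j)) :
    lagrangeInterp lo hi m v = lagrangeInterp lo hi m v' := by
  funext t
  exact Finset.sum_congr rfl fun j _ => by rw [h j]

lemma lagrangeInterp_sub (m : ℕ) (v v' : ℝ → X) (t : ℝ) :
    lagrangeInterp lo hi m (fun s => v s - v' s) t =
      lagrangeInterp lo hi m v t - lagrangeInterp lo hi m v' t := by
  simp [lagrangeInterp, smul_sub]

lemma lagrangeInterp_node (h : lo < hi) {m : ℕ} (v : ℝ → X) (j : Fin m) :
    lagrangeInterp lo hi m v (node lo hi m j) = v (node lo hi m j) := by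
  rw [lagrangeInterp, Finset.sum_eq_single j]
  · rw [Lagrange.eval_basis_self (node_injective h m).injOn (Finset.mem_univ j), one_smul]
  · intro k _ hk
    have := Lagrange.eval_basis_of_ne (v := fun k : Fin m => node lo hi m k) hk (Finset.mem_univ j)
    rw [this, zero_smul]
  · simp

lemma sum_basis_eval_mul_eval (h : lo < hi) {m : ℕ} {p : Polynomial ℝ} (hp : p.degree < m) (t : ℝ) :
    ∑ j : Fin m, (Lagrange.basis Finset.univ (fun k : Fin m => node lo hi m k) j).eval t *
      p.eval (node lo hi m j) = p.eval t := by
  conv_rhs => rw [Lagrange.eq_interpolate (s := Finset.univ) (f := p) (node_injective h m).injOn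
    (by simpa using hp), Lagrange.interpolate_apply, Polynomial.eval_finsetSum]
  simp [mul_comm]

/-- Interpolation reproduces polynomials of degree less than `m` with coefficients in `X`. -/
lemma lagrangeInterp_sum_eval_smul (h : lo < hi) {m : ℕ} {ι : Type*} (s : Finset ι)
    (p : ι → Polynomial ℝ) (x : ι → X) (hp : ∀ k ∈ s, (p k).degree < m) (t : ℝ) :
    lagrangeInterp lo hi m (fun r => ∑ k ∈ s, (p k).eval r • x k) t =
      ∑ k ∈ s, (p k).eval t • x k := by
  simp only [lagrangeInterp, Finset.smul_sum, smul_smul]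
  rw [Finset.sum_comm]
  refine Finset.sum_congr rfl fun k hk => ?_
  rw [← Finset.sum_smul, sum_basis_eval_mul_eval h (hp k hk)]

/-- The coarser operator sees only values at its own nodes; by nestedness these are nodes of the
finer interpolant, which agrees with `v` there. -/
lemma lagrangeInterp_smul_lagrangeInterp_of_le (h : lo < hi) {i j : ℕ} (hij : i ≤ j) (q : ℝ → ℝ)
    (v : ℝ → X) :
    lagrangeInterp lo hi (doubling i) (fun t => q t • lagrangeInterp lo hi (doubling j) v t) =
      lagrangeInterp lo hi (doubling i) fun t => q t • v t := by
  refine lagrangeInterp_congr fun k => ?_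
  obtain ⟨k', h1, h2⟩ := exists_node_eq (lo := lo) (hi := hi) hij k k.2
  have := lagrangeInterp_node h v (⟨k', h1⟩ : Fin (doubling j))
  simp only [← h2, this]

/-- The factor `t` brings the degree up to `m(j)`, so exact reproduction needs `m(j) < m(i)`, hence
the strict inequality `j < i`. -/
lemma lagrangeInterp_smul_lagrangeInterp_of_lt (h : lo < hi) {i j : ℕ} (hij : j < i) (v : ℝ → X) :
    lagrangeInterp lo hi (doubling i) (fun t => t • lagrangeInterp lo hi (doubling j) v t) =
      fun t => t • lagrangeInterp lo hi (doubling j) v t := by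
  have key : (fun t => t • lagrangeInterp lo hi (doubling j) v t) = fun t =>
      ∑ k : Fin (doubling j), (Polynomial.X * Lagrange.basis Finset.univ
        (fun k : Fin (doubling j) => node lo hi (doubling j) k) k).eval t •
        v (node lo hi (doubling j) k) := by
    funext t
    simp [lagrangeInterp, Finset.smul_sum, smul_smul]
  rw [key]
  funext t
  refine lagrangeInterp_sum_eval_smul h _ _ _ (fun k _ => ?_) t
  rw [Polynomial.degree_mul, Polynomial.degree_X,
    Lagrange.degree_basis (node_injective h _).injOn (Finset.mem_univ k)]
  have h1 := doubling_strictMono hij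
  have h2 := k.2
  rw [Finset.card_univ, Fintype.card_fin]
  norm_cast
  omega

lemma lagrangeInterp_lagrangeInterp_of_le (h : lo < hi) {i j : ℕ} (hij : i ≤ j) (v : ℝ → X) :
    lagrangeInterp lo hi (doubling i) (lagrangeInterp lo hi (doubling j) v) =
      lagrangeInterp lo hi (doubling i) v := by
  simpa using lagrangeInterp_smul_lagrangeInterp_of_le h hij (fun _ => 1) v

lemma lagrangeInterp_lagrangeInterp_of_ge (h : lo < hi) {i j : ℕ} (hij : j ≤ i) (v : ℝ → X) :
    lagrangeInterp lo hi (doubling i) (lagrangeInterp lo hi (doubling j) v) =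
      lagrangeInterp lo hi (doubling j) v := by
  funext t
  refine lagrangeInterp_sum_eval_smul h _ _ _ (fun k _ => ?_) t
  rw [Lagrange.degree_basis (node_injective h _).injOn (Finset.mem_univ k), Finset.card_univ,
    Fintype.card_fin]
  have h1 := doubling_strictMono.monotone hij
  have h2 := k.2
  norm_cast
  omega

lemma detail_detail_self (h : lo < hi) (i : ℕ) (v : ℝ → X) :
    detail lo hi i (detail lo hi i v) = detail lo hi i v := by
  funext t
  have e : detail lo hi i v = fun t => lagrangeInterp lo hi (doubling i) v t -
    lagrangeInterp lo hi (doubling (i - 1)) v t := rfl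
  conv_lhs => rw [detail, e, lagrangeInterp_sub, lagrangeInterp_sub,
    lagrangeInterp_lagrangeInterp_of_le h le_rfl, lagrangeInterp_lagrangeInterp_of_le h le_rfl,
    lagrangeInterp_lagrangeInterp_of_ge h (Nat.sub_le i 1),
    lagrangeInterp_lagrangeInterp_of_le h (Nat.sub_le i 1)]
  rw [detail]
  abel

/-- For `i < j` both interpolants inside `Δ_j` look like `v` to `Δ_i`; for `i > j` both interpolants
of `Δ_i` reproduce the polynomial `Δ_j v`. -/
lemma detail_detail_of_ne (h : lo < hi) {i j : ℕ} (hi1 : 1 ≤ i) (hj1 : 1 ≤ j) (hij : i ≠ j)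
    (v : ℝ → X) (t : ℝ) : detail lo hi i (detail lo hi j v) t = 0 := by
  have e : detail lo hi j v = fun t => lagrangeInterp lo hi (doubling j) v t -
    lagrangeInterp lo hi (doubling (j - 1)) v t := rfl
  rw [detail, e, lagrangeInterp_sub, lagrangeInterp_sub]
  rcases lt_or_gt_of_ne hij with hlt | hlt
  · rw [lagrangeInterp_lagrangeInterp_of_le h hlt.le,
      lagrangeInterp_lagrangeInterp_of_le h (show i ≤ j - 1 by omega),
      lagrangeInterp_lagrangeInterp_of_le h (show i - 1 ≤ j by omega),
      lagrangeInterp_lagrangeInterp_of_le h (show i - 1 ≤ j - 1 by omega)]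
    abel
  · rw [lagrangeInterp_lagrangeInterp_of_ge h hlt.le,
      lagrangeInterp_lagrangeInterp_of_ge h (show j - 1 ≤ i by omega),
      lagrangeInterp_lagrangeInterp_of_ge h (show j ≤ i - 1 by omega),
      lagrangeInterp_lagrangeInterp_of_ge h (show j - 1 ≤ i - 1 by omega)]
    abel

lemma detail_smul_detail (i j : ℕ) (v : ℝ → X) (t : ℝ) :
    detail lo hi i (fun s => s • detail lo hi j v s) t =
      (lagrangeInterp lo hi (doubling i) (fun s => s • lagrangeInterp lo hi (doubling j) v s) t -
      lagrangeInterp lo hi (doubling i)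
        (fun s => s • lagrangeInterp lo hi (doubling (j - 1)) v s) t) -
      (lagrangeInterp lo hi (doubling (i - 1))
        (fun s => s • lagrangeInterp lo hi (doubling j) v s) t -
      lagrangeInterp lo hi (doubling (i - 1))
        (fun s => s • lagrangeInterp lo hi (doubling (j - 1)) v s) t) := by
  simp only [detail, smul_sub, lagrangeInterp_sub]

/-- Written as a difference of two approximations of `t v`, the shape that is estimated for
holomorphic `v`. -/
lemma detail_smul_detail_self (h : lo < hi) {i : ℕ} (hi1 : 1 ≤ i) (v : ℝ → X) (t : ℝ) :
    detail lo hi i (fun s => s • detail lo hi i v s) t =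
      lagrangeInterp lo hi (doubling i) (fun s => s • v s) t -
        t • lagrangeInterp lo hi (doubling (i - 1)) v t := by
  rw [detail_smul_detail, lagrangeInterp_smul_lagrangeInterp_of_le h le_rfl,
    lagrangeInterp_smul_lagrangeInterp_of_lt h (show i - 1 < i by omega),
    lagrangeInterp_smul_lagrangeInterp_of_le h (show i - 1 ≤ i by omega),
    lagrangeInterp_smul_lagrangeInterp_of_le h (le_refl (i - 1))]
  abel

lemma detail_smul_detail_pred (h : lo < hi) {i : ℕ} (hi1 : 2 ≤ i) (v : ℝ → X) (t : ℝ) :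
    detail lo hi i (fun s => s • detail lo hi (i - 1) v s) t =
      t • lagrangeInterp lo hi (doubling (i - 1)) v t -
        lagrangeInterp lo hi (doubling (i - 1)) (fun s => s • v s) t := by
  rw [detail_smul_detail, lagrangeInterp_smul_lagrangeInterp_of_lt h (show i - 1 < i by omega),
    lagrangeInterp_smul_lagrangeInterp_of_lt h (show i - 1 - 1 < i by omega),
    lagrangeInterp_smul_lagrangeInterp_of_le h (le_refl (i - 1)),
    lagrangeInterp_smul_lagrangeInterp_of_lt h (show i - 1 - 1 < i - 1 by omega)]
  abel

/-- As for `detail_detail_of_ne`, except that the extra degree from `t` prevents cancellation at `j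
= i - 1`. -/
lemma detail_smul_detail_of_ne (h : lo < hi) {i j : ℕ} (hi1 : 1 ≤ i) (hj1 : 1 ≤ j) (h1 : j ≠ i)
    (h2 : j ≠ i - 1) (v : ℝ → X) (t : ℝ) :
    detail lo hi i (fun s => s • detail lo hi j v s) t = 0 := by
  rw [detail_smul_detail]
  rcases lt_or_gt_of_ne h1 with hlt | hlt
  · rw [lagrangeInterp_smul_lagrangeInterp_of_lt h hlt,
      lagrangeInterp_smul_lagrangeInterp_of_lt h (show j - 1 < i by omega),
      lagrangeInterp_smul_lagrangeInterp_of_lt h (show j < i - 1 by omega),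
      lagrangeInterp_smul_lagrangeInterp_of_lt h (show j - 1 < i - 1 by omega)]
    abel
  · rw [lagrangeInterp_smul_lagrangeInterp_of_le h hlt.le,
      lagrangeInterp_smul_lagrangeInterp_of_le h (show i ≤ j - 1 by omega),
      lagrangeInterp_smul_lagrangeInterp_of_le h (show i - 1 ≤ j by omega),
      lagrangeInterp_smul_lagrangeInterp_of_le h (show i - 1 ≤ j - 1 by omega)]
    abel

end Interpolation

/-! ### Aliasing of cosines on the Clenshaw–Curtis grid. -/

section Aliasing

/-- The angle of the `j`-th Clenshaw–Curtis node. -/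
noncomputable def ccAngle (m j : ℕ) : ℝ :=
  if m = 1 then Real.pi / 2 else Real.pi - Real.pi * (j : ℝ) / ((m : ℝ) - 1)

lemma ccNode_eq_cos (m j : ℕ) : ccNode m j = Real.cos (ccAngle m j) := by
  unfold ccNode ccAngle
  split_ifs <;> simp [Real.cos_pi_sub]

/-- On the Clenshaw–Curtis grid every cosine coincides with one of low frequency. -/
lemma exists_cos_mul_ccAngle_eq {m : ℕ} (hm : 2 ≤ m) (k : ℕ) :
    ∃ r < m, ∀ j : Fin m, Real.cos (k * ccAngle m j) = Real.cos (r * ccAngle m j) := by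
  obtain ⟨n, rfl⟩ : ∃ n, m = n + 1 := ⟨m - 1, by omega⟩
  have hn : 0 < n := by omega
  have hn' : (n : ℝ) ≠ 0 := by positivity
  have hang : ∀ j : Fin (n + 1), ∃ l : ℕ, ccAngle (n + 1) j = Real.pi * l / n := by
    intro j
    refine ⟨n - j, ?_⟩
    rw [ccAngle, if_neg (by omega), Nat.cast_sub (by omega)]
    push_cast
    rw [add_sub_cancel_right]
    field_simp
  -- At angles `π l / n` the cosine depends on `k` only modulo `2n` and is even in `k`, so a
  -- remainder `s > n` is reflected to `2n - s`.
  have hk : (k : ℝ) = 2 * n * (k / (2 * n) : ℕ) + (k % (2 * n) : ℕ) := by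
    exact_mod_cast (Nat.div_add_mod k (2 * n)).symm
  set q := k / (2 * n)
  set s := k % (2 * n) with hs
  have hsn : s < 2 * n := Nat.mod_lt _ (by omega)
  by_cases hcase : s ≤ n
  · refine ⟨s, by omega, fun j => ?_⟩
    obtain ⟨l, hl⟩ := hang j
    rw [hl, hk, ← Real.cos_add_nat_mul_two_pi (s * (Real.pi * l / n)) (q * l)]
    congr 1
    push_cast
    field_simp
    ring
  · refine ⟨2 * n - s, by omega, fun j => ?_⟩
    obtain ⟨l, hl⟩ := hang j
    rw [hl, hk, ← Real.cos_neg, Nat.cast_sub hsn.le,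
      ← Real.cos_sub_nat_mul_two_pi (((2 * n : ℕ) - s : ℝ) * (Real.pi * l / n)) ((q + 1) * l)]
    congr 1
    push_cast
    field_simp
    ring

variable {lo hi : ℝ}

/-- `cos rθ` is the Chebyshev polynomial `T_r` at `cos θ`, of degree `r < m`, hence reproduced by
interpolation. -/
lemma sum_basis_eval_mul_cos_of_lt (h : lo < hi) {m r : ℕ} (hr : r < m) (θ : ℝ) :
    ∑ j : Fin m, (Lagrange.basis Finset.univ (fun k : Fin m => node lo hi m k) j).eval
      ((lo + hi) / 2 + (hi - lo) / 2 * Real.cos θ) * Real.cos (r * ccAngle m j) =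
      Real.cos (r * θ) := by
  have hne : (hi - lo) / 2 ≠ 0 := by linarith
  set p : Polynomial ℝ := (Polynomial.Chebyshev.T ℝ r).comp
    (Polynomial.C ((hi - lo) / 2)⁻¹ * (Polynomial.X - Polynomial.C ((lo + hi) / 2))) with hp
  have heval : ∀ φ : ℝ, p.eval ((lo + hi) / 2 + (hi - lo) / 2 * Real.cos φ) = Real.cos (r * φ) := by
    intro φ
    rw [hp, Polynomial.eval_comp]
    simp only [Polynomial.eval_mul, Polynomial.eval_C, Polynomial.eval_sub, Polynomial.eval_X,
      add_sub_cancel_left, inv_mul_cancel_left₀ hne]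
    exact_mod_cast Polynomial.Chebyshev.T_real_cos φ r
  have hdeg : p.degree < m := by
    refine lt_of_le_of_lt Polynomial.degree_le_natDegree ?_
    rw [hp, Polynomial.natDegree_comp]
    have h1 : (Polynomial.Chebyshev.T ℝ (r : ℤ)).natDegree = r := by
      exact Polynomial.natDegree_eq_of_degree_eq_some (by simp)
    have h2 : (Polynomial.C ((hi - lo) / 2)⁻¹ *
        (Polynomial.X - Polynomial.C ((lo + hi) / 2))).natDegree = 1 := by
      rw [Polynomial.natDegree_C_mul (inv_ne_zero hne), Polynomial.natDegree_X_sub_C]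
    rw [h1, h2, mul_one]
    exact_mod_cast hr
  have := sum_basis_eval_mul_eval h hdeg ((lo + hi) / 2 + (hi - lo) / 2 * Real.cos θ)
  rw [heval] at this
  rw [← this]
  refine Finset.sum_congr rfl fun j _ => ?_
  rw [node, ccNode_eq_cos, heval]

/-- By aliasing, the interpolant of a cosine in at least two nodes is again a cosine. This replaces
a Lebesgue constant, so the error bound carries no factor growing with `m`. -/
lemma abs_sum_basis_eval_mul_cos_le (h : lo < hi) (m k : ℕ) (θ : ℝ) :
    |∑ j : Fin m, (Lagrange.basis Finset.univ (fun k : Fin m => node lo hi m k) j).eval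
      ((lo + hi) / 2 + (hi - lo) / 2 * Real.cos θ) * Real.cos (k * ccAngle m j)| ≤ 1 := by
  match m with
  | 0 => simp
  | 1 =>
    have := sum_basis_eval_mul_cos_of_lt h zero_lt_one θ
    simp only [Finset.univ_unique, Finset.sum_singleton, Nat.cast_zero, zero_mul, Real.cos_zero,
      mul_one] at this ⊢
    rw [this, one_mul]
    exact Real.abs_cos_le_one _
  | m + 2 =>
    obtain ⟨r, hr, hcos⟩ := exists_cos_mul_ccAngle_eq (m := m + 2) (by omega) k
    simp only [hcos]
    rw [sum_basis_eval_mul_cos_of_lt h hr]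
    exact Real.abs_cos_le_one _

end Aliasing

/-! ### Geometric convergence of interpolation. -/

section Error

open Metric

variable {E : Type*} [NormedAddCommGroup E] [NormedSpace ℂ E] [NormedSpace ℝ E]
  [IsScalarTower ℝ ℂ E] [CompleteSpace E] {lo hi τ M : ℝ}

/-- The parameter of the Bernstein ellipse in the `τ`-neighbourhood of `[lo, hi]`. -/
noncomputable def ellipseParam (lo hi τ : ℝ) : ℝ :=
  2 * τ / (hi - lo) + √(1 + 4 * τ ^ 2 / (hi - lo) ^ 2)

lemma ellipseParam_eq (lo hi τ : ℝ) :
    ellipseParam lo hi τ = 2 * τ / (hi - lo) + √(1 + (2 * τ / (hi - lo)) ^ 2) := by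
  rw [ellipseParam]; congr 3; rw [div_pow, mul_pow]; norm_num

lemma one_lt_ellipseParam (h : lo < hi) (hτ : 0 < τ) : 1 < ellipseParam lo hi τ := by
  rw [ellipseParam_eq]
  exact one_lt_add_sqrt (by have := sub_pos.2 h; positivity)

lemma infDist_affine_le (h : lo < hi) {z : ℂ}
    (hz : infDist z (Complex.ofReal '' Icc (-1) 1) ≤ 2 * τ / (hi - lo)) :
    infDist (((lo + hi) / 2 : ℝ) + ((hi - lo) / 2 : ℝ) * z) (Complex.ofReal '' Icc lo hi) ≤ τ := by
  have hd : 0 < hi - lo := sub_pos.2 h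
  have hcpt : IsCompact (Complex.ofReal '' Icc (-1) 1) :=
    isCompact_Icc.image Complex.continuous_ofReal
  obtain ⟨_, ⟨p, hp, rfl⟩, hpz⟩ := hcpt.exists_infDist_eq_dist
    ((nonempty_Icc.2 (by norm_num)).image _) z
  rw [hpz] at hz
  have hmem : (((lo + hi) / 2 + (hi - lo) / 2 * p : ℝ) : ℂ) ∈ Complex.ofReal '' Icc lo hi := by
    refine mem_image_of_mem _ ⟨?_, ?_⟩ <;> nlinarith [hp.1, hp.2]
  refine (infDist_le_dist_of_mem hmem).trans ?_
  have : (((lo + hi) / 2 : ℝ) + ((hi - lo) / 2 : ℝ) * z : ℂ) -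
      (((lo + hi) / 2 + (hi - lo) / 2 * p : ℝ) : ℂ) = ((hi - lo) / 2 : ℝ) * (z - p) := by
    push_cast; ring
  rw [dist_eq_norm, this, norm_mul, Complex.norm_real, Real.norm_of_nonneg (by positivity)]
  rw [dist_eq_norm, le_div_iff₀ hd] at hz
  linarith

/-- Geometric convergence of Clenshaw–Curtis interpolation of holomorphic functions. -/
lemma norm_sub_lagrangeInterp_le (h : lo < hi) (hτ : 0 < τ) {f : ℂ → E}
    (hd : ∀ z, infDist z (Complex.ofReal '' Icc lo hi) ≤ τ → DifferentiableAt ℂ f z)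
    (hM : ∀ z, infDist z (Complex.ofReal '' Icc lo hi) ≤ τ → ‖f z‖ ≤ M) (m : ℕ) {t : ℝ}
    (ht : t ∈ Icc lo hi) :
    ‖f t - lagrangeInterp lo hi m (fun s => f s) t‖ ≤
      4 / (1 - (ellipseParam lo hi τ)⁻¹) * M * (ellipseParam lo hi τ)⁻¹ ^ m := by
  have hl : 0 < hi - lo := sub_pos.2 h
  have hb : 0 < 2 * τ / (hi - lo) := by positivity
  obtain ⟨A, hA, hsum⟩ := hasSum_cos_of_differentiableAt (M := M) hb
    (f := fun z => f (((lo + hi) / 2 : ℝ) + ((hi - lo) / 2 : ℝ) * z))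
    (fun z hz => DifferentiableAt.comp z (hd _ (infDist_affine_le h hz)) (by fun_prop))
    (fun z hz => hM _ (infDist_affine_le h hz))
  rw [← ellipseParam_eq] at hA
  have hϱ := one_lt_ellipseParam h hτ
  set ϱ := ellipseParam lo hi τ
  have hϱi : ϱ⁻¹ < 1 := inv_lt_one_of_one_lt₀ hϱ
  have hϱ0 : 0 ≤ ϱ⁻¹ := by positivity
  have hM0 : 0 ≤ 2 * M := by simpa using (norm_nonneg _).trans (hA 0)
  have hsum' : ∀ θ : ℝ, HasSum (fun k : ℕ => Real.cos (k * θ) • A k)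
      (f ((lo + hi) / 2 + (hi - lo) / 2 * Real.cos θ : ℝ)) := by
    intro θ
    have := hsum θ
    simp only [← Complex.coe_algebraMap, algebraMap_smul] at this
    simpa using this
  obtain ⟨θ, rfl⟩ : ∃ θ, t = (lo + hi) / 2 + (hi - lo) / 2 * Real.cos θ := by
    refine ⟨Real.arccos ((t - (lo + hi) / 2) / ((hi - lo) / 2)), ?_⟩
    rw [Real.cos_arccos]
    · field_simp; ring
    · rw [le_div_iff₀ (by positivity)]; linarith [ht.1]
    · rw [div_le_iff₀ (by positivity)]; linarith [ht.2]
  set ℓ : Fin m → ℝ := fun j => (Lagrange.basis Finset.univ (fun k : Fin m => node lo hi m k) j).eval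
    ((lo + hi) / 2 + (hi - lo) / 2 * Real.cos θ) with hℓ
  set e : ℕ → ℝ := fun k => Real.cos (k * θ) - ∑ j, ℓ j * Real.cos (k * ccAngle m j) with he
  have hdiff : HasSum (fun k => e k • A k)
      (f ((lo + hi) / 2 + (hi - lo) / 2 * Real.cos θ : ℝ) -
        lagrangeInterp lo hi m (fun s => f s) ((lo + hi) / 2 + (hi - lo) / 2 * Real.cos θ)) := by
    have h1 : HasSum (fun k : ℕ => ∑ j, ℓ j • (Real.cos (k * ccAngle m j) • A k))
        (lagrangeInterp lo hi m (fun s => f s) ((lo + hi) / 2 + (hi - lo) / 2 * Real.cos θ)) := by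
      refine hasSum_sum fun j _ => ?_
      rw [node, ccNode_eq_cos]
      exact (hsum' _).const_smul _
    convert (hsum' θ).sub h1 using 2 with k
    rw [he, sub_smul, Finset.sum_smul]
    simp only [smul_smul]
  -- Frequencies below `m` are reproduced exactly, so only the tail `k ≥ m` remains; `|e k| ≤ 2` and
  -- `‖A k‖ ≤ 2 M ϱ⁻¹ ^ k` produce the constant `4`.
  have hzero : ∀ k < m, e k = 0 := fun k hk => by
    rw [he]; exact sub_eq_zero.2 (sum_basis_eval_mul_cos_of_lt h hk θ).symm
  have htwo : ∀ k, |e k| ≤ 2 := by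
    intro k
    refine (abs_sub _ _).trans ?_
    linarith [Real.abs_cos_le_one (k * θ), abs_sum_basis_eval_mul_cos_le h m k θ]
  have hshift := (hasSum_nat_add_iff' m).2 hdiff
  rw [Finset.sum_eq_zero (fun k hk => by rw [hzero k (Finset.mem_range.1 hk), zero_smul]),
    sub_zero] at hshift
  have hgeo := (hasSum_geometric_of_lt_one hϱ0 hϱi).mul_left (4 * M * ϱ⁻¹ ^ m)
  refine (hshift.norm_le_of_bounded hgeo fun k => ?_).trans_eq ?_
  · rw [norm_smul, Real.norm_eq_abs]
    calc _ ≤ 2 * (2 * M * ϱ⁻¹ ^ (k + m)) :=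
          mul_le_mul (htwo _) (hA _) (norm_nonneg _) (by norm_num)
      _ = _ := by rw [pow_add]; ring
  · rw [div_eq_mul_inv]; ring

end Error

/-! ### Operators acting in separate variables. -/

section TensorOperators

variable {X Y : Type*}

/-- The operators `T n` applied in the variables `n ∈ L`, one after the other. -/
def tensorOp {N : ℕ} (T : Fin N → (ℝ → X) → ℝ → X) (L : List (Fin N)) (F : (Fin N → ℝ) → X) :
    (Fin N → ℝ) → X :=
  L.foldr (fun n G => onCoord (T n) n G) F

variable {N : ℕ}

lemma onCoord_onCoord (A B : (ℝ → X) → ℝ → X) (n : Fin N) (F : (Fin N → ℝ) → X) :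
    onCoord A n (onCoord B n F) = onCoord (fun h => A (B h)) n F := by
  funext y
  simp [onCoord]

lemma tensorOp_cons (T : Fin N → (ℝ → X) → ℝ → X) (n : Fin N) (L : List (Fin N))
    (F : (Fin N → ℝ) → X) : tensorOp T (n :: L) F = onCoord (T n) n (tensorOp T L F) := rfl

variable [AddCommGroup X] [Module ℝ X] [AddCommGroup Y] [Module ℝ Y]

/-- Operators on `X`-valued functions of one variable such that `T h t` is a finite linear
combination of values of `h`, at points of `Γ` if `t ∈ Γ`. -/
def IsFiniteKernelOn (Γ : Set ℝ) (T : (ℝ → X) → ℝ → X) : Prop :=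
  ∃ κ : ℝ → ℝ →₀ ℝ, (∀ h t, T h t = (κ t).sum fun s c => c • h s) ∧
    ∀ t ∈ Γ, ∀ s ∈ (κ t).support, s ∈ Γ

variable {Γ : Set ℝ}

lemma isFiniteKernelOn_lagrangeInterp {lo hi : ℝ} (h : lo ≤ hi) (m : ℕ) :
    IsFiniteKernelOn (Icc lo hi) (lagrangeInterp lo hi m : (ℝ → X) → ℝ → X) := by
  refine ⟨fun t => ∑ j : Fin m, Finsupp.single (node lo hi m j)
    ((Lagrange.basis Finset.univ (fun k : Fin m => node lo hi m k) j).eval t), fun v t => ?_,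
    fun t _ s hs => ?_⟩
  · rw [← Finsupp.sum_finsetSum_index (by simp) (by simp [add_smul])]
    simp [lagrangeInterp]
  · obtain ⟨j, -, hj⟩ := Finset.mem_biUnion.1 (Finsupp.support_finsetSum hs)
    rw [Finset.mem_singleton.1 (Finsupp.support_single_subset hj)]
    exact node_mem_Icc h m j

lemma isFiniteKernelOn_id : IsFiniteKernelOn Γ (fun h : ℝ → X => h) :=
  ⟨fun t => Finsupp.single t 1, fun h t => by simp, fun t ht s hs => by
    rwa [Finset.mem_singleton.1 (Finsupp.support_single_subset hs)]⟩

lemma IsFiniteKernelOn.smul {T : (ℝ → X) → ℝ → X} (hT : IsFiniteKernelOn Γ T) (q : ℝ → ℝ) :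
    IsFiniteKernelOn Γ fun h t => q t • T h t := by
  obtain ⟨κ, h1, h2⟩ := hT
  refine ⟨fun t => q t • κ t, fun h t => ?_, fun t ht s hs => h2 t ht s (Finsupp.support_smul hs)⟩
  change q t • T h t = _
  rw [Finsupp.sum_smul_index (by simp), h1, Finsupp.smul_sum]
  simp [mul_smul]

lemma IsFiniteKernelOn.sub {T T' : (ℝ → X) → ℝ → X} (hT : IsFiniteKernelOn Γ T)
    (hT' : IsFiniteKernelOn Γ T') : IsFiniteKernelOn Γ fun h t => T h t - T' h t := by
  classical
  obtain ⟨κ, h1, h2⟩ := hT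
  obtain ⟨κ', h1', h2'⟩ := hT'
  refine ⟨fun t => κ t - κ' t, fun h t => ?_, fun t ht s hs => ?_⟩
  · change T h t - T' h t = _
    rw [Finsupp.sum_sub_index (by simp [sub_smul]), h1, h1']
  · rcases Finset.mem_union.1 (Finsupp.support_sub hs) with hs | hs
    exacts [h2 t ht s hs, h2' t ht s hs]

lemma IsFiniteKernelOn.comp {T T' : (ℝ → X) → ℝ → X} (hT : IsFiniteKernelOn Γ T)
    (hT' : IsFiniteKernelOn Γ T') : IsFiniteKernelOn Γ fun h => T (T' h) := by
  classical
  obtain ⟨κ, h1, h2⟩ := hT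
  obtain ⟨κ', h1', h2'⟩ := hT'
  refine ⟨fun t => (κ t).sum fun s c => c • κ' s, fun h t => ?_, fun t ht s hs => ?_⟩
  · change T (T' h) t = _
    rw [Finsupp.sum_sum_index (by simp) (by simp [add_smul]), h1]
    refine Finsupp.sum_congr fun s _ => ?_
    rw [h1', Finsupp.sum_smul_index (by simp), Finsupp.smul_sum]
    simp [mul_smul]
  · obtain ⟨r, hr, hs⟩ := Finset.mem_biUnion.1 (Finsupp.support_finsetSum hs)
    exact h2' r (h2 t ht r hr) s (Finsupp.support_smul hs)

lemma isFiniteKernelOn_detail {lo hi : ℝ} (h : lo ≤ hi) (i : ℕ) :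
    IsFiniteKernelOn (Icc lo hi) (detail lo hi i : (ℝ → X) → ℝ → X) :=
  (isFiniteKernelOn_lagrangeInterp h _).sub (isFiniteKernelOn_lagrangeInterp h _)

/-- With both operators written as finite combinations of point values, commutation is an exchange
of two finite sums. -/
lemma onCoord_comm {A B : (ℝ → X) → ℝ → X} {Γ' : Set ℝ} (hA : IsFiniteKernelOn Γ A)
    (hB : IsFiniteKernelOn Γ' B) {n m : Fin N} (hnm : n ≠ m) (F : (Fin N → ℝ) → X) :
    onCoord A n (onCoord B m F) = onCoord B m (onCoord A n F) := by
  obtain ⟨κ, h1, -⟩ := hA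
  obtain ⟨κ', h1', -⟩ := hB
  funext y
  simp only [onCoord, h1, h1', Finsupp.smul_sum, Function.update_of_ne hnm,
    Function.update_of_ne hnm.symm]
  rw [Finsupp.sum_comm]
  refine Finsupp.sum_congr fun s _ => Finsupp.sum_congr fun r _ => ?_
  rw [smul_comm, Function.update_comm hnm]

variable {Γ : Fin N → Set ℝ}

lemma tensorOp_onCoord_comm {A : Fin N → (ℝ → X) → ℝ → X} (hA : ∀ n, IsFiniteKernelOn (Γ n) (A n))
    {B : (ℝ → X) → ℝ → X} {n : Fin N} (hB : IsFiniteKernelOn (Γ n) B) {L : List (Fin N)}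
    (hn : n ∉ L) (F : (Fin N → ℝ) → X) :
    tensorOp A L (onCoord B n F) = onCoord B n (tensorOp A L F) := by
  induction L with
  | nil => rfl
  | cons k L ih =>
    rw [List.mem_cons, not_or] at hn
    rw [tensorOp_cons, tensorOp_cons, ih hn.2, onCoord_comm (hA k) hB (Ne.symm hn.1)]

lemma tensorOp_tensorOp {A B : Fin N → (ℝ → X) → ℝ → X} (hA : ∀ n, IsFiniteKernelOn (Γ n) (A n))
    (hB : ∀ n, IsFiniteKernelOn (Γ n) (B n)) {L : List (Fin N)} (hL : L.Nodup)
    (F : (Fin N → ℝ) → X) :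
    tensorOp A L (tensorOp B L F) = tensorOp (fun n h => A n (B n h)) L F := by
  induction L with
  | nil => rfl
  | cons k L ih =>
    rw [List.nodup_cons] at hL
    rw [tensorOp_cons, tensorOp_cons, tensorOp_onCoord_comm hA (hB k) hL.1, ih hL.2,
      onCoord_onCoord, tensorOp_cons]

/-- Absorbs an operator in one variable, such as multiplication by `yₙ`, into the matching tensor
factor. -/
lemma tensorOp_onCoord {A : Fin N → (ℝ → X) → ℝ → X} (hA : ∀ n, IsFiniteKernelOn (Γ n) (A n))
    {B : (ℝ → X) → ℝ → X} {n : Fin N} (hB : IsFiniteKernelOn (Γ n) B) {L : List (Fin N)}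
    (hL : L.Nodup) (hn : n ∈ L) (F : (Fin N → ℝ) → X) :
    tensorOp A L (onCoord B n F) = tensorOp (Function.update A n fun h => A n (B h)) L F := by
  induction L with
  | nil => simp at hn
  | cons k L ih =>
    rw [List.nodup_cons] at hL
    rw [tensorOp_cons, tensorOp_cons]
    by_cases hk : k = n
    · subst hk
      rw [tensorOp_onCoord_comm hA hB hL.1, onCoord_onCoord, Function.update_self]
      congr 1
      refine (List.foldr_ext _ _ _ fun m hm G => ?_)
      rw [Function.update_of_ne]
      rintro rfl
      exact hL.1 hm
    · rw [Function.update_of_ne hk, ih hL.2 ((List.mem_cons.1 hn).resolve_left (Ne.symm hk))]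

lemma tensorOp_eq_zero {T : Fin N → (ℝ → X) → ℝ → X} (hT : ∀ n, IsFiniteKernelOn (Γ n) (T n))
    {n : Fin N} (hzero : ∀ h t, T n h t = 0) {L : List (Fin N)} (hn : n ∈ L)
    (F : (Fin N → ℝ) → X) (y : Fin N → ℝ) : tensorOp T L F y = 0 := by
  induction L generalizing y with
  | nil => simp at hn
  | cons k L ih =>
    rw [tensorOp_cons, onCoord]
    by_cases hk : k = n
    · rw [hk, hzero]
    · obtain ⟨κ, h1, -⟩ := hT k
      simp [h1, ih ((List.mem_cons.1 hn).resolve_left (Ne.symm hk))]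

lemma surplus_eq_tensorOp (lo hi : Fin N → ℝ) (i : Fin N → ℕ) (F : (Fin N → ℝ) → X) :
    surplus lo hi i F = tensorOp (fun n => detail (lo n) (hi n) (i n)) (List.finRange N) F := rfl

/-- Hierarchical surpluses commute with linear maps. -/
lemma map_surplus (φ : X →ₗ[ℝ] Y) (lo hi : Fin N → ℝ) (i : Fin N → ℕ) (F : (Fin N → ℝ) → X)
    (y : Fin N → ℝ) : φ (surplus lo hi i F y) = surplus lo hi i (fun y => φ (F y)) y := by
  rw [surplus_eq_tensorOp, surplus_eq_tensorOp]
  induction List.finRange N generalizing y with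
  | nil => rfl
  | cons n L ih => simp [tensorOp_cons, onCoord, detail, lagrangeInterp, ← ih]

/-- Transfers a linear relation valid for every `y` to the surplus; `surplus_flux_ae_eq` applies it
to an almost-everywhere identity. -/
lemma surplus_mem (R : Submodule ℝ X) (lo hi : Fin N → ℝ) (i : Fin N → ℕ) (F : (Fin N → ℝ) → X)
    (hF : ∀ y, F y ∈ R) (y : Fin N → ℝ) : surplus lo hi i F y ∈ R := by
  have := map_surplus R.subtype lo hi i (fun y => ⟨F y, hF y⟩) y
  simp only [Submodule.subtype_apply] at this
  exact this ▸ Subtype.coe_prop _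

lemma surplus_sum {ι : Type*} (s : Finset ι) (lo hi : Fin N → ℝ) (i : Fin N → ℕ)
    (F : ι → (Fin N → ℝ) → X) (y : Fin N → ℝ) :
    surplus lo hi i (fun y => ∑ j ∈ s, F j y) y = ∑ j ∈ s, surplus lo hi i (F j) y := by
  have h := map_surplus (∑ j ∈ s, LinearMap.proj j : (ι → X) →ₗ[ℝ] X) lo hi i
    (fun y j => F j y) y
  simp only [LinearMap.sum_apply, LinearMap.proj_apply] at h
  rw [← h]
  exact Finset.sum_congr rfl fun j _ => map_surplus (LinearMap.proj j : (ι → X) →ₗ[ℝ] X) ..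

end TensorOperators

/-! ### From one-dimensional bounds to tensor products. -/

section TensorBounds

open Metric

variable {E : Type*} [NormedAddCommGroup E] [NormedSpace ℂ E] [NormedSpace ℝ E]
  [IsScalarTower ℝ ℂ E] {N : ℕ}

/-- Bounds on holomorphic functions of one variable tensorize. -/
lemma norm_tensorOp_le {Γ : Fin N → Set ℝ} {S : Fin N → Set ℂ}
    (hΓS : ∀ n, ∀ t ∈ Γ n, (t : ℂ) ∈ S n) {T : Fin N → (ℝ → E) → ℝ → E}
    (hT : ∀ n, IsFiniteKernelOn (Γ n) (T n)) {q : Fin N → ℝ}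
    (hq : ∀ n (h : ℂ → E) (M : ℝ), (∀ z ∈ S n, DifferentiableAt ℂ h z) →
      (∀ z ∈ S n, ‖h z‖ ≤ M) → ∀ t ∈ Γ n, ‖T n (fun s => h s) t‖ ≤ q n * M)
    {F : (Fin N → ℂ) → E} {F₀ : (Fin N → ℝ) → E} {M : ℝ}
    (hd : ∀ z, (∀ n, z n ∈ S n) → DifferentiableAt ℂ F z)
    (hM : ∀ z, (∀ n, z n ∈ S n) → ‖F z‖ ≤ M)
    (hF : ∀ y, (∀ n, y n ∈ Γ n) → F₀ y = F fun n => (y n : ℂ)) {y : Fin N → ℝ}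
    (hy : ∀ n, y n ∈ Γ n) {L : List (Fin N)} (hL : L.Nodup) :
    ‖tensorOp T L F₀ y‖ ≤ (L.map q).prod * M := by
  -- The induction needs a holomorphic bounded extension, not just a norm. Coordinates in `L` are
  -- frozen at `y`, since nothing is assumed about how `T n h t` depends on `t`.
  suffices ∃ P : (Fin N → ℂ) → E, (∀ z, (∀ n, z n ∈ S n) → DifferentiableAt ℂ P z) ∧
      (∀ z, (∀ n, z n ∈ S n) → ‖P z‖ ≤ (L.map q).prod * M) ∧
      ∀ x : Fin N → ℝ, (∀ n, x n ∈ Γ n) → (∀ n ∈ L, x n = y n) →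
        tensorOp T L F₀ x = P fun n => (x n : ℂ) by
    obtain ⟨P, -, h2, h3⟩ := this
    rw [h3 y hy fun _ _ => rfl]
    exact h2 _ fun n => hΓS n _ (hy n)
  induction L with
  | nil => exact ⟨F, hd, by simpa using hM, fun x hx _ => hF x hx⟩
  | cons n L ih =>
    rw [List.nodup_cons] at hL
    obtain ⟨P, h1, h2, h3⟩ := ih hL.2
    obtain ⟨κ, hκ, hκΓ⟩ := hT n
    have hup : ∀ z : Fin N → ℂ, (∀ k, z k ∈ S k) → ∀ w ∈ S n, ∀ k, Function.update z n w k ∈ S k := by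
      intro z hz w hw k
      by_cases hk : k = n
      · subst hk; simpa using hw
      · simpa [hk] using hz k
    -- A finite combination of slices of `P` at real points of `Γ n`, hence still holomorphic in the
    -- other variables.
    refine ⟨fun z => (κ (y n)).sum fun s c => c • P (Function.update z n (s : ℂ)), ?_, ?_, ?_⟩
    · intro z hz
      refine DifferentiableAt.fun_sum fun s hs => ?_
      refine DifferentiableAt.const_smul ?_ _
      have h4 := h1 _ (hup z hz _ (hΓS n s (hκΓ _ (hy n) s hs)))
      refine DifferentiableAt.comp z h4 (differentiableAt_pi.2 fun k => ?_)
      by_cases hk : k = n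
      · subst hk; simp
      · simpa [hk] using differentiableAt_apply k z
    · intro z hz
      have h4 := hq n (fun w => P (Function.update z n w)) ((L.map q).prod * M)
        (fun w hw => (h1 _ (hup z hz w hw)).comp w
          (differentiableAt_pi.2 fun k => ?_)) (fun w hw => h2 _ (hup z hz w hw)) (y n) (hy n)
      · rw [hκ] at h4
        rw [List.map_cons, List.prod_cons, mul_assoc]
        exact h4
      · by_cases hk : k = n
        · subst hk; simp
        · simp [hk]
    · intro x hx hxy
      rw [tensorOp_cons, onCoord, hxy n (by simp), hκ]
      refine Finsupp.sum_congr fun s hs => ?_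
      have hs' := hκΓ _ (hy n) s hs
      rw [h3]
      · congr 2
        funext k
        by_cases hk : k = n
        · subst hk; simp
        · simp [hk]
      · intro k
        by_cases hk : k = n
        · subst hk; simpa using hs'
        · simpa [hk] using hx k
      · intro k hk
        have : k ≠ n := by rintro rfl; exact hL.1 hk
        simpa [this] using hxy k (List.mem_cons_of_mem _ hk)

variable {lo hi τ M : ℝ}

/-- A constant for the one-dimensional estimates on `[lo, hi]`. -/
noncomputable def detailConst (lo hi τ : ℝ) : ℝ :=
  8 / (1 - (ellipseParam lo hi τ)⁻¹) * (|lo| + |hi| + τ + 1)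

lemma one_le_detailConst (h : lo < hi) (hτ : 0 < τ) : 1 ≤ detailConst lo hi τ := by
  have h1 := one_lt_ellipseParam h hτ
  have h2 : (ellipseParam lo hi τ)⁻¹ < 1 := inv_lt_one_of_one_lt₀ h1
  have h3 : 0 < (ellipseParam lo hi τ)⁻¹ := by positivity
  have h4 : 1 ≤ 8 / (1 - (ellipseParam lo hi τ)⁻¹) := by
    rw [le_div_iff₀ (by linarith)]; linarith
  have h5 : 1 ≤ |lo| + |hi| + τ + 1 := by linarith [abs_nonneg lo, abs_nonneg hi]
  exact one_le_mul_of_one_le_of_one_le h4 h5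

lemma norm_le_of_infDist_le (h : lo < hi) {z : ℂ}
    (hz : infDist z (Complex.ofReal '' Icc lo hi) ≤ τ) : ‖z‖ ≤ |lo| + |hi| + τ + 1 := by
  obtain ⟨_, ⟨p, hp, rfl⟩, hpz⟩ := (isCompact_Icc.image Complex.continuous_ofReal
    ).exists_infDist_eq_dist ((nonempty_Icc.2 h.le).image _) z
  rw [hpz, dist_eq_norm] at hz
  have h1 : ‖(p : ℂ)‖ ≤ |lo| + |hi| := by
    rw [Complex.norm_real, Real.norm_eq_abs]
    exact (abs_le_max_abs_abs hp.1 hp.2).trans (max_le (by simp) (by simp))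
  have := norm_le_norm_add_norm_sub' z (p : ℂ)
  linarith

variable [CompleteSpace E]

/-- The weight bounds `|z|` on the neighbourhood, so one constant serves both `f` and `z f(z)`. It
is half of `detailConst` because two such errors are added later. -/
lemma norm_sub_lagrangeInterp_le' (h : lo < hi) (hτ : 0 < τ) {f : ℂ → E}
    (hd : ∀ z, infDist z (Complex.ofReal '' Icc lo hi) ≤ τ → DifferentiableAt ℂ f z)
    (hM : ∀ z, infDist z (Complex.ofReal '' Icc lo hi) ≤ τ → ‖f z‖ ≤ M) {m m' : ℕ} (hm : m' ≤ m)
    {t : ℝ} (ht : t ∈ Icc lo hi) :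
    (|lo| + |hi| + τ + 1) * ‖f t - lagrangeInterp lo hi m (fun s => f s) t‖ ≤
      detailConst lo hi τ / 2 * M * (ellipseParam lo hi τ)⁻¹ ^ m' := by
  have h1 := one_lt_ellipseParam h hτ
  have h2 : (ellipseParam lo hi τ)⁻¹ < 1 := inv_lt_one_of_one_lt₀ h1
  have h3 : 0 < (ellipseParam lo hi τ)⁻¹ := by positivity
  have hM0 : 0 ≤ M := (norm_nonneg _).trans (hM t (by
    rw [infDist_zero_of_mem (mem_image_of_mem _ ht)]; exact hτ.le))
  have h4 : 0 ≤ 4 / (1 - (ellipseParam lo hi τ)⁻¹) * M :=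
    mul_nonneg (div_nonneg (by norm_num) (by linarith)) hM0
  calc _ ≤ (|lo| + |hi| + τ + 1) *
        (4 / (1 - (ellipseParam lo hi τ)⁻¹) * M * (ellipseParam lo hi τ)⁻¹ ^ m') := by
        gcongr
        exact (norm_sub_lagrangeInterp_le h hτ hd hM m ht).trans
          (mul_le_mul_of_nonneg_left (pow_le_pow_of_le_one h3.le h2.le hm) h4)
    _ = _ := by rw [detailConst]; ring

/-- Apply the previous estimate to `z f(z)`: its bound gains exactly the weight on the left, which
cancels. -/
lemma norm_sub_lagrangeInterp_smul_le (h : lo < hi) (hτ : 0 < τ) {f : ℂ → E}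
    (hd : ∀ z, infDist z (Complex.ofReal '' Icc lo hi) ≤ τ → DifferentiableAt ℂ f z)
    (hM : ∀ z, infDist z (Complex.ofReal '' Icc lo hi) ≤ τ → ‖f z‖ ≤ M) {m m' : ℕ} (hm : m' ≤ m)
    {t : ℝ} (ht : t ∈ Icc lo hi) :
    ‖t • f t - lagrangeInterp lo hi m (fun s => s • f s) t‖ ≤
      detailConst lo hi τ / 2 * M * (ellipseParam lo hi τ)⁻¹ ^ m' := by
  have hR : 0 < |lo| + |hi| + τ + 1 := by positivity
  have key := norm_sub_lagrangeInterp_le' h hτ (f := fun z => z • f z)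
    (M := (|lo| + |hi| + τ + 1) * M) (fun z hz => differentiableAt_id.smul (hd z hz))
    (fun z hz => by
      rw [norm_smul]
      exact mul_le_mul (norm_le_of_infDist_le h hz) (hM z hz) (norm_nonneg _) hR.le) hm ht
  have hsmul : ∀ s : ℝ, (s : ℂ) • f s = s • f s := fun s => by
    rw [← Complex.coe_algebraMap, algebraMap_smul]
  simp only [hsmul] at key
  refine le_of_mul_le_mul_left (key.trans_eq ?_) hR
  ring

lemma norm_detail_le (h : lo < hi) (hτ : 0 < τ) {f : ℂ → E}
    (hd : ∀ z, infDist z (Complex.ofReal '' Icc lo hi) ≤ τ → DifferentiableAt ℂ f z)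
    (hM : ∀ z, infDist z (Complex.ofReal '' Icc lo hi) ≤ τ → ‖f z‖ ≤ M) (i : ℕ)
    {t : ℝ} (ht : t ∈ Icc lo hi) :
    ‖detail lo hi i (fun s => f s) t‖ ≤
      detailConst lo hi τ * M * (ellipseParam lo hi τ)⁻¹ ^ doubling (i - 1) := by
  have hR : 1 ≤ |lo| + |hi| + τ + 1 := by linarith [abs_nonneg lo, abs_nonneg hi]
  have hmono := doubling_strictMono.monotone (Nat.sub_le i 1)
  have h1 := (le_mul_of_one_le_left (norm_nonneg _) hR).trans
    (norm_sub_lagrangeInterp_le' h hτ hd hM le_rfl ht (m := doubling (i - 1)))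
  have h2 := (le_mul_of_one_le_left (norm_nonneg _) hR).trans
    (norm_sub_lagrangeInterp_le' h hτ hd hM hmono ht)
  rw [detail, ← sub_sub_sub_cancel_left _ _ (f t)]
  refine (norm_sub_le _ _).trans ?_
  linarith

/-- Both terms are compared with `t f(t)`. The case `m' = m` serves `Δ_i (t Δ_{i-1})`, the case of
consecutive levels serves `Δ_i (t Δ_i)`. -/
lemma norm_smul_sub_lagrangeInterp_le (h : lo < hi) (hτ : 0 < τ) {f : ℂ → E}
    (hd : ∀ z, infDist z (Complex.ofReal '' Icc lo hi) ≤ τ → DifferentiableAt ℂ f z)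
    (hM : ∀ z, infDist z (Complex.ofReal '' Icc lo hi) ≤ τ → ‖f z‖ ≤ M) {m m' : ℕ} (hm : m' ≤ m)
    {t : ℝ} (ht : t ∈ Icc lo hi) :
    ‖lagrangeInterp lo hi m (fun s => s • f s) t - t • lagrangeInterp lo hi m' (fun s => f s) t‖ ≤
      detailConst lo hi τ * M * (ellipseParam lo hi τ)⁻¹ ^ m' := by
  have h1 := norm_sub_lagrangeInterp_le' h hτ hd hM (le_refl m') ht
  have h2 := norm_sub_lagrangeInterp_smul_le h hτ hd hM hm ht
  have h3 : |t| ≤ |lo| + |hi| + τ + 1 := by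
    have := norm_le_of_infDist_le (τ := τ) h (z := t) (by
      rw [infDist_zero_of_mem (mem_image_of_mem _ ht)]; exact hτ.le)
    rwa [Complex.norm_real] at this
  rw [← sub_sub_sub_cancel_left _ _ (t • f t), ← smul_sub]
  refine (norm_sub_le _ _).trans ?_
  rw [norm_smul, Real.norm_eq_abs]
  have h4 := mul_le_mul_of_nonneg_right h3
    (norm_nonneg (f t - lagrangeInterp lo hi m' (fun s => f s) t))
  linarith

end TensorBounds

/-! ### Orthogonality and decay of the surpluses. -/

section SurplusBounds

open Metric

variable {E : Type*} [NormedAddCommGroup E] [NormedSpace ℂ E] [NormedSpace ℝ E]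
  [IsScalarTower ℝ ℂ E] {N : ℕ} {lo hi τ : Fin N → ℝ} {M : ℝ}
  {F : (Fin N → ℂ) → E} {F₀ : (Fin N → ℝ) → E}

lemma inv_ellipseParam_pow_le (hlohi : ∀ n, lo n < hi n) (hτ : ∀ n, 0 < τ n) (n : Fin N) (m : ℕ) :
    (ellipseParam (lo n) (hi n) (τ n))⁻¹ ^ m ≤ Real.exp (-rate lo hi τ * m) := by
  have h1 := one_lt_ellipseParam (hlohi n) (hτ n)
  have h2 : rate lo hi τ ≤ Real.log (ellipseParam (lo n) (hi n) (τ n)) :=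
    ciInf_le (Set.finite_range _).bddBelow n
  have h3 : ellipseParam (lo n) (hi n) (τ n) =
      Real.exp (Real.log (ellipseParam (lo n) (hi n) (τ n))) :=
    (Real.exp_log (by linarith)).symm
  rw [h3, ← Real.exp_neg, ← Real.exp_nat_mul]
  refine Real.exp_le_exp.2 ?_
  have : (0 : ℝ) ≤ m := Nat.cast_nonneg m
  nlinarith

lemma ofReal_mem_Sig (hτ : ∀ n, 0 < τ n) {y : Fin N → ℝ} (hy : y ∈ Icc lo hi) :
    (fun n => (y n : ℂ)) ∈ Sig lo hi τ := fun n => by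
  have : (y n : ℂ) ∈ Complex.ofReal '' Icc (lo n) (hi n) :=
    mem_image_of_mem _ ⟨hy.1 n, hy.2 n⟩
  rw [infDist_zero_of_mem this]
  exact (hτ n).le

/-- Tensor products of operators with the one-dimensional decay of the details. -/
lemma norm_tensorOp_le_exp (hlohi : ∀ n, lo n < hi n) (hτ : ∀ n, 0 < τ n)
    (hd : ∀ z ∈ Sig lo hi τ, DifferentiableAt ℂ F z) (hM : ∀ z ∈ Sig lo hi τ, ‖F z‖ ≤ M)
    (hF : ∀ y ∈ Icc lo hi, F₀ y = F fun n => (y n : ℂ)) (i : Fin N → ℕ)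
    {T : Fin N → (ℝ → E) → ℝ → E} (hT : ∀ n, IsFiniteKernelOn (Icc (lo n) (hi n)) (T n))
    (hq : ∀ n (h : ℂ → E) (M : ℝ),
      (∀ z, infDist z (Complex.ofReal '' Icc (lo n) (hi n)) ≤ τ n → DifferentiableAt ℂ h z) →
      (∀ z, infDist z (Complex.ofReal '' Icc (lo n) (hi n)) ≤ τ n → ‖h z‖ ≤ M) →
      ∀ t ∈ Icc (lo n) (hi n), ‖T n (fun s => h s) t‖ ≤ detailConst (lo n) (hi n) (τ n) * M *
        (ellipseParam (lo n) (hi n) (τ n))⁻¹ ^ doubling (i n - 1))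
    {y : Fin N → ℝ} (hy : y ∈ Icc lo hi) :
    ‖tensorOp T (List.finRange N) F₀ y‖ ≤
      (∏ n, detailConst (lo n) (hi n) (τ n)) * Real.exp (-rate lo hi τ * shiftedLevel i) * M := by
  have hM0 : 0 ≤ M := (norm_nonneg _).trans (hM _ (ofReal_mem_Sig hτ hy))
  refine (norm_tensorOp_le (Γ := fun n => Icc (lo n) (hi n))
    (S := fun n => {z | infDist z (Complex.ofReal '' Icc (lo n) (hi n)) ≤ τ n})
    (fun n t ht => ?_) hT
    (q := fun n => detailConst (lo n) (hi n) (τ n) *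
      (ellipseParam (lo n) (hi n) (τ n))⁻¹ ^ doubling (i n - 1))
    (fun n h M h1 h2 t ht => (hq n h M h1 h2 t ht).trans_eq (by ring))
    hd hM (fun y hy => hF y ⟨fun n => (hy n).1, fun n => (hy n).2⟩)
    (fun n => ⟨hy.1 n, hy.2 n⟩) (List.nodup_finRange N)).trans ?_
  · rw [mem_ofPred_eq, infDist_zero_of_mem (mem_image_of_mem _ ht)]
    exact (hτ n).le
  · rw [← List.ofFn_eq_map, List.prod_ofFn, Finset.prod_mul_distrib, shiftedLevel]
    push_cast
    rw [Finset.mul_sum, Real.exp_sum]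
    refine mul_le_mul_of_nonneg_right (mul_le_mul_of_nonneg_left ?_ ?_) hM0
    · refine Finset.prod_le_prod (fun n _ => ?_) fun n _ => inv_ellipseParam_pow_le hlohi hτ n _
      have := one_lt_ellipseParam (hlohi n) (hτ n)
      positivity
    · exact Finset.prod_nonneg fun n _ => zero_le_one.trans (one_le_detailConst (hlohi n) (hτ n))

variable [CompleteSpace E]

lemma norm_surplus_le (hlohi : ∀ n, lo n < hi n) (hτ : ∀ n, 0 < τ n)
    (hd : ∀ z ∈ Sig lo hi τ, DifferentiableAt ℂ F z) (hM : ∀ z ∈ Sig lo hi τ, ‖F z‖ ≤ M)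
    (hF : ∀ y ∈ Icc lo hi, F₀ y = F fun n => (y n : ℂ)) (i : Fin N → ℕ)
    {y : Fin N → ℝ} (hy : y ∈ Icc lo hi) :
    ‖surplus lo hi i F₀ y‖ ≤
      (∏ n, detailConst (lo n) (hi n) (τ n)) * Real.exp (-rate lo hi τ * shiftedLevel i) * M :=
  norm_tensorOp_le_exp hlohi hτ hd hM hF i (fun n => isFiniteKernelOn_detail (hlohi n).le _)
    (fun n _ _ h1 h2 _ ht => norm_detail_le (hlohi n) (hτ n) h1 h2 _ ht) hy

lemma surplus_surplus_self {X : Type*} [AddCommGroup X] [Module ℝ X] (hlohi : ∀ n, lo n < hi n)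
    (i : Fin N → ℕ) (G : (Fin N → ℝ) → X) :
    surplus lo hi i (surplus lo hi i G) = surplus lo hi i G := by
  simp only [surplus_eq_tensorOp]
  rw [tensorOp_tensorOp (fun n => isFiniteKernelOn_detail (hlohi n).le _)
    (fun n => isFiniteKernelOn_detail (hlohi n).le _) (List.nodup_finRange N)]
  simp only [detail_detail_self (hlohi _)]

lemma surplus_surplus_of_ne {X : Type*} [AddCommGroup X] [Module ℝ X] (hlohi : ∀ n, lo n < hi n)
    {i j : Fin N → ℕ} (hi1 : ∀ n, 1 ≤ i n) (hj1 : ∀ n, 1 ≤ j n) (hij : i ≠ j)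
    (G : (Fin N → ℝ) → X) (y : Fin N → ℝ) :
    surplus lo hi i (surplus lo hi j G) y = 0 := by
  obtain ⟨n, hn⟩ := Function.ne_iff.1 hij
  simp only [surplus_eq_tensorOp]
  rw [tensorOp_tensorOp (fun n => isFiniteKernelOn_detail (hlohi n).le _)
    (fun n => isFiniteKernelOn_detail (hlohi n).le _) (List.nodup_finRange N)]
  exact tensorOp_eq_zero (fun n => (isFiniteKernelOn_detail (hlohi n).le _).comp
    (isFiniteKernelOn_detail (hlohi n).le _))
    (fun h t => detail_detail_of_ne (hlohi n) (hi1 n) (hj1 n) hn h t) (List.mem_finRange n) G y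

/-- The operator `Δ^{m(i)} (yₙ Δ^{m(j)} ·)` is a tensor product. -/
lemma surplus_smul_surplus {X : Type*} [AddCommGroup X] [Module ℝ X] (hlohi : ∀ n, lo n < hi n)
    (i j : Fin N → ℕ) (n : Fin N) (G : (Fin N → ℝ) → X) :
    surplus lo hi i (fun y => y n • surplus lo hi j G y) =
      tensorOp (fun k h => detail (lo k) (hi k) (i k)
        (fun t => (if k = n then t else 1) • detail (lo k) (hi k) (j k) h t)) (List.finRange N) G := by
  have hmul : (fun y => y n • surplus lo hi j G y) =
      onCoord (fun (h : ℝ → X) t => t • h t) n (surplus lo hi j G) := by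
    funext y
    simp [onCoord]
  have hk : IsFiniteKernelOn (Icc (lo n) (hi n)) (fun (h : ℝ → X) t => t • h t) :=
    isFiniteKernelOn_id.smul fun t => t
  have hA : ∀ k, IsFiniteKernelOn (Icc (lo k) (hi k))
      (detail (lo k) (hi k) (i k) : (ℝ → X) → ℝ → X) :=
    fun k => isFiniteKernelOn_detail (hlohi k).le _
  rw [hmul, surplus_eq_tensorOp, surplus_eq_tensorOp, tensorOp_onCoord hA hk
    (List.nodup_finRange N) (List.mem_finRange n), tensorOp_tensorOp (Γ := fun k => Icc (lo k) (hi k))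
    (fun k => ?_) (fun k => isFiniteKernelOn_detail (hlohi k).le _) (List.nodup_finRange N)]
  · congr 1
    funext k h
    by_cases hkn : k = n
    · subst hkn; simp
    · simp [hkn]
  · by_cases hkn : k = n
    · subst hkn
      rw [Function.update_self]
      exact (hA k).comp hk
    · rw [Function.update_of_ne hkn]
      exact hA k

lemma isFiniteKernelOn_detail_smul_detail {X : Type*} [AddCommGroup X] [Module ℝ X] {a b : ℝ}
    (h : a ≤ b) (i j : ℕ) (q : ℝ → ℝ) : IsFiniteKernelOn (Icc a b)
      (fun (v : ℝ → X) => detail a b i (fun t => q t • detail a b j v t)) :=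
  (isFiniteKernelOn_detail h i).comp ((isFiniteKernelOn_detail h j).smul q)

/-- One vanishing factor kills the tensor product: a coordinate `k ≠ n` with `j k ≠ i k`, or else
coordinate `n` itself. -/
lemma surplus_smul_surplus_of_ne {X : Type*} [AddCommGroup X] [Module ℝ X]
    (hlohi : ∀ n, lo n < hi n) {i j : Fin N → ℕ} (hi1 : ∀ n, 1 ≤ i n) (hj1 : ∀ n, 1 ≤ j n)
    {n : Fin N} (hij : j ≠ i) (hij' : j ≠ i - Pi.single n 1) (G : (Fin N → ℝ) → X)
    (y : Fin N → ℝ) : surplus lo hi i (fun y => y n • surplus lo hi j G y) y = 0 := by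
  rw [surplus_smul_surplus hlohi]
  have hker := fun k => isFiniteKernelOn_detail_smul_detail (X := X) (hlohi k).le (i k) (j k)
    fun t => if k = n then t else 1
  by_cases hk : ∃ k, k ≠ n ∧ j k ≠ i k
  · obtain ⟨k, hkn, hk⟩ := hk
    refine tensorOp_eq_zero hker (n := k) (fun h t => ?_) (List.mem_finRange k) G y
    simp only [if_neg hkn, one_smul]
    exact detail_detail_of_ne (hlohi k) (hi1 k) (hj1 k) hk.symm h t
  · push Not at hk
    refine tensorOp_eq_zero hker (n := n) (fun h t => ?_) (List.mem_finRange n) G y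
    simp only [if_true]
    refine detail_smul_detail_of_ne (hlohi n) (hi1 n) (hj1 n) (fun hn => hij ?_)
      (fun hn => hij' ?_) h t
    · funext k
      by_cases hkn : k = n
      · rw [hkn, hn]
      · exact hk k hkn
    · funext k
      rw [sub_single_apply]
      split_ifs with hkn
      · rw [hkn, hn]
      · exact hk k hkn

lemma norm_surplus_smul_surplus_le (hlohi : ∀ n, lo n < hi n) (hτ : ∀ n, 0 < τ n)
    (hd : ∀ z ∈ Sig lo hi τ, DifferentiableAt ℂ F z) (hM : ∀ z ∈ Sig lo hi τ, ‖F z‖ ≤ M)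
    (hF : ∀ y ∈ Icc lo hi, F₀ y = F fun n => (y n : ℂ)) {i j : Fin N → ℕ} (hi1 : ∀ n, 1 ≤ i n)
    (hj1 : ∀ n, 1 ≤ j n) {n : Fin N} (hij : j = i ∨ j = i - Pi.single n 1)
    {y : Fin N → ℝ} (hy : y ∈ Icc lo hi) :
    ‖surplus lo hi i (fun y => y n • surplus lo hi j F₀ y) y‖ ≤
      (∏ n, detailConst (lo n) (hi n) (τ n)) * Real.exp (-rate lo hi τ * shiftedLevel i) * M := by
  rw [surplus_smul_surplus hlohi]
  refine norm_tensorOp_le_exp hlohi hτ hd hM hF i (fun k =>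
    isFiniteKernelOn_detail_smul_detail (hlohi k).le _ _ _) (fun k h M h1 h2 t ht => ?_) hy
  by_cases hkn : k = n
  · subst hkn
    simp only [if_true]
    rcases hij with hij | hij
    · rw [hij, detail_smul_detail_self (hlohi k) (hi1 k)]
      exact norm_smul_sub_lagrangeInterp_le (hlohi k) (hτ k) h1 h2
        (doubling_strictMono.monotone (Nat.sub_le _ _)) ht
    · have hjk : j k = i k - 1 := by rw [hij, sub_single_apply, if_pos rfl]
      have h2i : 2 ≤ i k := by have := hj1 k; omega
      rw [hjk, detail_smul_detail_pred (hlohi k) h2i, ← norm_neg, neg_sub]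
      exact norm_smul_sub_lagrangeInterp_le (hlohi k) (hτ k) h1 h2 le_rfl ht
  · have hjk : j k = i k := by
      rcases hij with hij | hij
      · rw [hij]
      · rw [hij, sub_single_apply, if_neg hkn]
    simp only [if_neg hkn, one_smul]
    rw [hjk]
    have := detail_detail_self (hlohi k) (i k) fun s : ℝ => h s
    exact (congrArg norm (congrFun this t)).le.trans
      (norm_detail_le (hlohi k) (hτ k) h1 h2 _ ht)

/-- Only `j = i` survives in the expansion of `S_I`, so the bound does not depend on `I`. -/
lemma norm_surplus_sparseInterp_le (hlohi : ∀ n, lo n < hi n) (hτ : ∀ n, 0 < τ n)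
    (hd : ∀ z ∈ Sig lo hi τ, DifferentiableAt ℂ F z) (hM : ∀ z ∈ Sig lo hi τ, ‖F z‖ ≤ M)
    (hF : ∀ y ∈ Icc lo hi, F₀ y = F fun n => (y n : ℂ)) {i : Fin N → ℕ} (hi1 : ∀ n, 1 ≤ i n)
    {I : Finset (Fin N → ℕ)} (hI : IsIndexSet I) {y : Fin N → ℝ} (hy : y ∈ Icc lo hi) :
    ‖surplus lo hi i (sparseInterp lo hi I F₀) y‖ ≤
      (∏ n, detailConst (lo n) (hi n) (τ n)) * Real.exp (-rate lo hi τ * shiftedLevel i) * M := by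
  have h0 := norm_surplus_le hlohi hτ hd hM hF i hy
  have : surplus lo hi i (sparseInterp lo hi I F₀) y = ∑ j ∈ I,
      surplus lo hi i (surplus lo hi j F₀) y := surplus_sum I lo hi i (fun j => surplus lo hi j F₀) y
  rw [this]
  by_cases hiI : i ∈ I
  · rw [Finset.sum_eq_single i (fun j hj hji =>
      surplus_surplus_of_ne hlohi hi1 (hI j hj) hji.symm F₀ y) (fun h => absurd hiI h),
      surplus_surplus_self hlohi]
    exact h0
  · rw [Finset.sum_eq_zero fun j hj => surplus_surplus_of_ne hlohi hi1 (hI j hj)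
      (fun h => hiI (h ▸ hj)) F₀ y, norm_zero]
    exact (norm_nonneg _).trans h0

/-- Only `j = i` and `j = i - eₙ` can survive, whence the factor `2`. -/
lemma norm_surplus_smul_sparseInterp_le (hlohi : ∀ n, lo n < hi n) (hτ : ∀ n, 0 < τ n)
    (hd : ∀ z ∈ Sig lo hi τ, DifferentiableAt ℂ F z) (hM : ∀ z ∈ Sig lo hi τ, ‖F z‖ ≤ M)
    (hF : ∀ y ∈ Icc lo hi, F₀ y = F fun n => (y n : ℂ)) {i : Fin N → ℕ} (hi1 : ∀ n, 1 ≤ i n)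
    {I : Finset (Fin N → ℕ)} (hI : IsIndexSet I) (n : Fin N) {y : Fin N → ℝ} (hy : y ∈ Icc lo hi) :
    ‖surplus lo hi i (fun y => y n • sparseInterp lo hi I F₀ y) y‖ ≤
      2 * ((∏ n, detailConst (lo n) (hi n) (τ n)) *
        Real.exp (-rate lo hi τ * shiftedLevel i) * M) := by
  classical
  have h0 := (norm_nonneg _).trans (norm_surplus_le hlohi hτ hd hM hF i hy)
  have : surplus lo hi i (fun y => y n • sparseInterp lo hi I F₀ y) y = ∑ j ∈ I,
      surplus lo hi i (fun y => y n • surplus lo hi j F₀ y) y := by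
    rw [← surplus_sum]
    simp only [sparseInterp, Finset.smul_sum]
  rw [this, ← Finset.sum_filter_of_ne (p := fun j => j ∈ ({i, i - Pi.single n 1} : Finset _))]
  · refine (norm_sum_le_of_le (n := fun _ => (∏ n, detailConst (lo n) (hi n) (τ n)) *
      Real.exp (-rate lo hi τ * shiftedLevel i) * M) _ fun j hj => ?_).trans ?_
    · rw [Finset.mem_filter, Finset.mem_insert, Finset.mem_singleton] at hj
      exact norm_surplus_smul_surplus_le hlohi hτ hd hM hF hi1 (hI j hj.1) hj.2 hy
    · rw [Finset.sum_const, nsmul_eq_mul]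
      refine mul_le_mul_of_nonneg_right ?_ h0
      exact_mod_cast (Finset.card_le_card fun j hj => (Finset.mem_filter.1 hj).2).trans
        Finset.card_le_two
  · intro j hj hne
    by_contra hcon
    rw [Finset.mem_insert, Finset.mem_singleton, not_or] at hcon
    exact hne (surplus_smul_surplus_of_ne hlohi hi1 (hI j hj) hcon.1 hcon.2 F₀ y)

end SurplusBounds

/-! ### Weak gradients and complexification. -/

section WeakGradient

variable {𝕜 : Type} [RCLike 𝕜] {d : ℕ} {D : Set (EuclideanSpace ℝ (Fin d))}

lemma inner_toLp_ofReal {ψ : EuclideanSpace ℝ (Fin d) → ℝ}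
    (hψ : MemLp (fun x => (ψ x : 𝕜)) 2 (domainMeasure D)) (f : Lp 𝕜 2 (domainMeasure D)) :
    inner 𝕜 (hψ.toLp _) f = ∫ x in D, ψ x • f x := by
  rw [L2.inner_def]
  refine integral_congr_ae ?_
  filter_upwards [hψ.coeFn_toLp] with x hx
  rw [hx, RCLike.inner_apply, RCLike.conj_ofReal, RCLike.real_smul_eq_coe_mul, mul_comm]

/-- The components of a vector field in `L²`. -/
noncomputable def componentLp (k : Fin d) :
    Lp (EuclideanSpace 𝕜 (Fin d)) 2 (domainMeasure D) →L[𝕜] Lp 𝕜 2 (domainMeasure D) :=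
  (EuclideanSpace.proj k : EuclideanSpace 𝕜 (Fin d) →L[𝕜] 𝕜).compLpL 2 _

lemma coeFn_componentLp (k : Fin d) (g : Lp (EuclideanSpace 𝕜 (Fin d)) 2 (domainMeasure D)) :
    componentLp k g =ᵐ[domainMeasure D] fun x => g x k :=
  (EuclideanSpace.proj k : EuclideanSpace 𝕜 (Fin d) →L[𝕜] 𝕜).coeFn_compLpL g

lemma memLp_ofReal_of_hasCompactSupport {ψ : EuclideanSpace ℝ (Fin d) → ℝ} (hψ : Continuous ψ)
    (hs : HasCompactSupport ψ) : MemLp (fun x => (ψ x : 𝕜)) 2 (domainMeasure D) :=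
  Continuous.memLp_of_hasCompactSupport (RCLike.continuous_ofReal.comp hψ)
    (hs.comp_left RCLike.ofReal_zero)

lemma integral_smul_classicalGrad {φ : EuclideanSpace ℝ (Fin d) → 𝕜}
    {ψ : EuclideanSpace ℝ (Fin d) → ℝ} (hφ : ContDiff ℝ ∞ φ) (hψ : ContDiff ℝ ∞ ψ)
    (hψs : HasCompactSupport ψ) (hψD : tsupport ψ ⊆ D) (k : Fin d) :
    ∫ x in D, ψ x • classicalGrad φ x k =
      -∫ x in D, fderiv ℝ ψ x (EuclideanSpace.single k 1) • φ x := by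
  have hψ0 : ∀ x ∉ D, ψ x = 0 := fun x hx => image_eq_zero_of_notMem_tsupport fun h => hx (hψD h)
  have hψ1 : ∀ x ∉ D, fderiv ℝ ψ x = 0 := fun x hx =>
    image_eq_zero_of_notMem_tsupport fun h => hx (hψD (tsupport_fderiv_subset ℝ h))
  have hφ' : Continuous fun x => fderiv ℝ φ x (EuclideanSpace.single k 1) :=
    (hφ.continuous_fderiv (by simp)).clm_apply continuous_const
  have hψ' : Continuous fun x => fderiv ℝ ψ x (EuclideanSpace.single k 1) :=
    (hψ.continuous_fderiv (by simp)).clm_apply continuous_const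
  have hψs' : HasCompactSupport fun x => fderiv ℝ ψ x (EuclideanSpace.single k 1) :=
    hψs.fderiv_apply ℝ _
  -- Both integrands vanish off `D`, so the integration by parts takes place on the whole space
  -- without boundary terms.
  rw [setIntegral_eq_integral_of_forall_compl_eq_zero fun x hx => by rw [hψ0 x hx, zero_smul],
    setIntegral_eq_integral_of_forall_compl_eq_zero fun x hx => by simp [hψ1 x hx]]
  refine integral_smul_fderiv_eq_neg_fderiv_smul_of_integrable ?_ ?_ ?_
    (fun x _ => (hψ.differentiable (by simp)).differentiableAt)
    (fun x _ => (hφ.differentiable (by simp)).differentiableAt)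
  · exact (hψ'.smul hφ.continuous).integrable_of_hasCompactSupport hψs'.smul_right
  · exact (hψ.continuous.smul hφ').integrable_of_hasCompactSupport hψs.smul_right
  · exact (hψ.continuous.smul hφ.continuous).integrable_of_hasCompactSupport hψs.smul_right

/-- The gradient of an element of `H¹₀(D)` is its weak gradient. -/
lemma integral_smul_grad (v : H10 𝕜 D) {ψ : EuclideanSpace ℝ (Fin d) → ℝ} (hψ : ContDiff ℝ ∞ ψ)
    (hψs : HasCompactSupport ψ) (hψD : tsupport ψ ⊆ D) (k : Fin d) :
    ∫ x in D, ψ x • componentLp k v.grad x =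
      -∫ x in D, fderiv ℝ ψ x (EuclideanSpace.single k 1) • v.value x := by
  have hψ' : Continuous fun x => fderiv ℝ ψ x (EuclideanSpace.single k 1) :=
    (hψ.continuous_fderiv (by simp)).clm_apply continuous_const
  have hψs' : HasCompactSupport fun x => fderiv ℝ ψ x (EuclideanSpace.single k 1) :=
    hψs.fderiv_apply ℝ _
  have m0 := memLp_ofReal_of_hasCompactSupport (𝕜 := 𝕜) (D := D) hψ.continuous hψs
  have m1 := memLp_ofReal_of_hasCompactSupport (𝕜 := 𝕜) (D := D) hψ' hψs'
  -- The weak-derivative identity says that this continuous functional vanishes. It does so on the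
  -- test pairs, hence on the closure of their span.
  let Φ : GraphSpace 𝕜 D →L[𝕜] 𝕜 :=
    (innerSL 𝕜 (m0.toLp _)).comp ((componentLp k).comp (WithLp.sndL 2 𝕜 _ _)) +
      (innerSL 𝕜 (m1.toLp _)).comp (WithLp.fstL 2 𝕜 _ _)
  have hΦ : ∀ p : GraphSpace 𝕜 D, Φ p = (∫ x in D, ψ x • componentLp k p.snd x) +
      ∫ x in D, fderiv ℝ ψ x (EuclideanSpace.single k 1) • p.fst x := by
    intro p
    rw [← inner_toLp_ofReal m0, ← inner_toLp_ofReal m1]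
    rfl
  have hle : (Submodule.span 𝕜 (testPairs 𝕜 D)).topologicalClosure ≤ Φ.ker := by
    refine Submodule.topologicalClosure_minimal _ (Submodule.span_le.2 ?_) Φ.isClosed_ker
    rintro p ⟨φ, hφ, -, -, h1, h2⟩
    change Φ p = 0
    have e1 : ∫ x in D, ψ x • componentLp k p.snd x = ∫ x in D, ψ x • classicalGrad φ x k := by
      refine integral_congr_ae ?_
      filter_upwards [coeFn_componentLp k p.snd, h2] with x hx hx2
      rw [hx, hx2]
    have e2 : ∫ x in D, fderiv ℝ ψ x (EuclideanSpace.single k 1) • p.fst x =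
        ∫ x in D, fderiv ℝ ψ x (EuclideanSpace.single k 1) • φ x := by
      refine integral_congr_ae ?_
      filter_upwards [h1] with x hx
      rw [hx]
    rw [hΦ, e1, e2, integral_smul_classicalGrad hφ hψ hψs hψD, neg_add_cancel]
  have h0 : Φ v.1 = 0 := hle v.2
  rw [hΦ] at h0
  exact eq_neg_of_add_eq_zero_left h0

/-- The inclusion `ℝᵈ → ℂᵈ`. -/
noncomputable def complexify (d : ℕ) : EuclideanSpace ℝ (Fin d) →ₗᵢ[ℝ] EuclideanSpace ℂ (Fin d) where
  toFun x := WithLp.toLp 2 fun k => (x k : ℂ)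
  map_add' x y := by ext k; simp
  map_smul' c x := by ext k; simp
  norm_map' x := by simp [EuclideanSpace.norm_eq]

/-- The inclusion `L²(D; ℝᵈ) → L²(D; ℂᵈ)`. -/
noncomputable def complexifyLp (D : Set (EuclideanSpace ℝ (Fin d))) :
    Lp (EuclideanSpace ℝ (Fin d)) 2 (domainMeasure D) →L[ℝ]
      Lp (EuclideanSpace ℂ (Fin d)) 2 (domainMeasure D) :=
  (complexify d).toContinuousLinearMap.compLpL 2 _

lemma coeFn_complexifyLp (g : Lp (EuclideanSpace ℝ (Fin d)) 2 (domainMeasure D)) :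
    complexifyLp D g =ᵐ[domainMeasure D] fun x => complexify d (g x) :=
  (complexify d).toContinuousLinearMap.coeFn_compLpL g

lemma norm_complexifyLp (g : Lp (EuclideanSpace ℝ (Fin d)) 2 (domainMeasure D)) :
    ‖complexifyLp D g‖ = ‖g‖ := by
  rw [Lp.norm_def, Lp.norm_def]
  congr 1
  refine eLpNorm_congr_norm_ae ?_
  filter_upwards [coeFn_complexifyLp g] with x hx
  rw [hx, LinearIsometry.norm_map]

/-- The weak gradient is determined by the function: if `U` is the complexification of `u`, then so
is its gradient. -/
lemma grad_eq_complexifyLp_grad (hD : IsOpen D) {u : H10 ℝ D} {U : H10 ℂ D}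
    (h : (U.value : EuclideanSpace ℝ (Fin d) → ℂ) =ᵐ[domainMeasure D] fun x => (u.value x : ℂ)) :
    U.grad = complexifyLp D u.grad := by
  have hk : ∀ k, ∀ᵐ x ∂(domainMeasure D), U.grad x k = complexifyLp D u.grad x k := by
    intro k
    set g : Lp ℂ 2 (domainMeasure D) := componentLp k U.grad - componentLp k (complexifyLp D u.grad)
      with hg
    -- Tested against smooth `ψ`, the difference of the gradients involves only `U.value` and
    -- `u.value`, which agree; the fundamental lemma of the calculus of variations concludes.
    have hg0 : ∀ᵐ x ∂(domainMeasure D), x ∈ D → g x = 0 := by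
      refine hD.ae_eq_zero_of_integral_contDiff_smul_eq_zero
        (((Lp.memLp g).locallyIntegrable (by norm_num)).locallyIntegrableOn D) fun ψ hψ hψs hψD => ?_
      have m0 := memLp_ofReal_of_hasCompactSupport (𝕜 := ℂ) (D := D) hψ.continuous hψs
      rw [← inner_toLp_ofReal m0, hg, inner_sub_right, inner_toLp_ofReal m0, inner_toLp_ofReal m0,
        integral_smul_grad U hψ hψs hψD]
      have e1 : ∫ x in D, fderiv ℝ ψ x (EuclideanSpace.single k 1) • U.value x =
          ((∫ x in D, fderiv ℝ ψ x (EuclideanSpace.single k 1) • u.value x : ℝ) : ℂ) := by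
        rw [← integral_complex_ofReal]
        refine integral_congr_ae ?_
        filter_upwards [h] with x hx
        simp [hx]
      have e2 : ∫ x in D, ψ x • componentLp k (complexifyLp D u.grad) x =
          ((∫ x in D, ψ x • componentLp k u.grad x : ℝ) : ℂ) := by
        rw [← integral_complex_ofReal]
        refine integral_congr_ae ?_
        filter_upwards [coeFn_componentLp k u.grad, coeFn_complexifyLp u.grad,
          coeFn_componentLp k (complexifyLp D u.grad)] with x h1 h2 h3
        simp [h1, h2, h3, complexify]
      rw [e1, e2, integral_smul_grad u hψ hψs hψD]
      simp
    filter_upwards [hg0, ae_restrict_mem hD.measurableSet, coeFn_componentLp k U.grad,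
      coeFn_componentLp k (complexifyLp D u.grad),
      Lp.coeFn_sub (componentLp k U.grad) (componentLp k (complexifyLp D u.grad))]
      with x h1 h2 h3 h4 h5
    have := h1 h2
    rw [hg, h5, Pi.sub_apply, h3, h4] at this
    exact sub_eq_zero.1 this
  refine Lp.ext ?_
  filter_upwards [ae_all_iff.2 hk] with x hx
  ext k
  exact hx k

end WeakGradient

/-! ### Boundedness of the coefficient functions. -/

section CoefficientBounds

/-- Resampling one coordinate preserves a product of probability measures. -/
lemma measurePreserving_update {ι : Type*} [Fintype ι] [DecidableEq ι] {α : ι → Type*}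
    [∀ i, MeasurableSpace (α i)] (μ : ∀ i, Measure (α i)) [∀ i, IsProbabilityMeasure (μ i)] (n : ι) :
    MeasurePreserving (fun p : (∀ i, α i) × α n => Function.update p.1 n p.2)
      ((Measure.pi μ).prod (μ n)) (Measure.pi μ) := by
  have hmeas : Measurable fun p : (∀ i, α i) × α n => Function.update p.1 n p.2 := by
    refine measurable_pi_lambda _ fun k => ?_
    by_cases hk : k = n
    · subst hk; simpa using measurable_snd
    · simpa [hk, Function.comp_def] using (measurable_pi_apply k).comp measurable_fst
  refine ⟨hmeas, (Measure.pi_eq fun s hs => ?_).symm⟩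
  rw [Measure.map_apply hmeas (MeasurableSet.univ_pi hs)]
  have : (fun p : (∀ i, α i) × α n => Function.update p.1 n p.2) ⁻¹' univ.pi s =
      univ.pi (Function.update s n univ) ×ˢ s n := by
    ext ⟨y, t⟩
    simp only [mem_preimage, mem_univ_pi, mem_prod]
    constructor
    · refine fun h => ⟨fun k => ?_, by simpa using h n⟩
      by_cases hk : k = n
      · subst hk; simp
      · simpa [hk] using h k
    · rintro ⟨h1, h2⟩ k
      by_cases hk : k = n
      · subst hk; simpa using h2
      · simpa [hk] using h1 k
  rw [this, Measure.prod_prod, Measure.pi_pi, ← Finset.mul_prod_erase _ _ (Finset.mem_univ n),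
    ← Finset.mul_prod_erase (a := n) Finset.univ (fun i => μ i (s i)) (Finset.mem_univ n),
    Function.update_self, measure_univ, one_mul, mul_comm]
  congr 1
  refine Finset.prod_congr rfl fun k hk => ?_
  rw [Function.update_of_ne (Finset.ne_of_mem_erase hk)]

variable {N d : ℕ} {lo hi : Fin N → ℝ} {ρ : Fin N → ℝ → ℝ≥0}
  {D : Set (EuclideanSpace ℝ (Fin d))} {a₀ : EuclideanSpace ℝ (Fin d) → ℝ}
  {a : Fin N → EuclideanSpace ℝ (Fin d) → ℝ} {amin amax : ℝ}

lemma coeff_update_sub (y : Fin N → ℝ) (n : Fin N) (t : ℝ) (x : EuclideanSpace ℝ (Fin d)) :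
    coeff a₀ a (Function.update y n t) x - coeff a₀ a y x = a n x * (t - y n) := by
  rw [coeff, coeff, add_sub_add_left_eq_sub, ← Finset.sum_sub_distrib, Finset.sum_eq_single n]
  · rw [Function.update_self]; ring
  · intro k _ hk
    rw [Function.update_of_ne hk, sub_self]
  · simp

/-- The coefficient functions of a uniformly elliptic affine diffusion coefficient are bounded. -/
lemma exists_bound_coeff (hρ_one : ∀ n, ∫⁻ t in Icc (lo n) (hi n), (ρ n t : ℝ≥0∞) = 1)
    (hamin : 0 < amin)
    (ha : ∀ᵐ y ∂(paramLaw lo hi ρ), ∀ x ∈ D, amin ≤ coeff a₀ a y x ∧ coeff a₀ a y x ≤ amax) :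
    ∃ K : ℝ, 0 < K ∧ ∀ x ∈ D, |a₀ x| ≤ K ∧ ∀ n, |a n x| ≤ K := by
  set μ : Fin N → Measure ℝ := fun n =>
    (volume.restrict (Icc (lo n) (hi n))).withDensity fun t => (ρ n t : ℝ≥0∞) with hμ
  have hprob : ∀ n, IsProbabilityMeasure (μ n) := fun n =>
    ⟨by rw [hμ, withDensity_apply _ MeasurableSet.univ, Measure.restrict_univ, hρ_one n]⟩
  change ∀ᵐ y ∂(Measure.pi μ), _ at ha
  -- Resampling coordinate `n` of an admissible parameter gives almost surely another admissible
  -- one, and a law with a density has no atom at `y n`. The difference quotient of the coefficient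
  -- then bounds `aₙ`.
  have hpair : ∀ n, ∃ (y : Fin N → ℝ) (t : ℝ), t ≠ y n ∧
      (∀ x ∈ D, amin ≤ coeff a₀ a y x ∧ coeff a₀ a y x ≤ amax) ∧
      ∀ x ∈ D, amin ≤ coeff a₀ a (Function.update y n t) x ∧
        coeff a₀ a (Function.update y n t) x ≤ amax := by
    intro n
    have h2 := (measurePreserving_update μ n).quasiMeasurePreserving.ae ha
    obtain ⟨y, hy1, hy2⟩ := (ha.and (Measure.ae_ae_of_ae_prod h2)).exists
    have hne : ∀ᵐ t ∂(μ n), t ≠ y n :=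
      (withDensity_absolutelyContinuous _ _).ae_le (ae_restrict_of_ae (Measure.ae_ne volume (y n)))
    obtain ⟨t, ht1, ht2⟩ := (hy2.and hne).exists
    exact ⟨y, t, ht2, hy1, ht1⟩
  have hK : ∀ n, ∃ K : ℝ, 0 ≤ K ∧ ∀ x ∈ D, |a n x| ≤ K := by
    intro n
    obtain ⟨y, t, hne, h1, h2⟩ := hpair n
    have hpos : 0 < |t - y n| := abs_pos.2 (sub_ne_zero.2 hne)
    refine ⟨|amax - amin| / |t - y n|, by positivity, fun x hx => ?_⟩
    rw [le_div_iff₀ hpos, ← abs_mul, ← coeff_update_sub (a₀ := a₀)]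
    refine (abs_le.2 ⟨?_, ?_⟩).trans (le_abs_self _)
    · linarith [(h1 x hx).2, (h2 x hx).1]
    · linarith [(h1 x hx).1, (h2 x hx).2]
  choose K hK0 hK using hK
  obtain ⟨y, hy⟩ := ha.exists
  refine ⟨|amax| + ∑ n, K n * |y n| + ∑ n, K n + 1, ?_, fun x hx => ⟨?_, fun n => ?_⟩⟩
  · have h1 : 0 ≤ ∑ n, K n * |y n| := Finset.sum_nonneg fun n _ => mul_nonneg (hK0 n) (abs_nonneg _)
    have h2 : 0 ≤ ∑ n, K n := Finset.sum_nonneg fun n _ => hK0 n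
    positivity
  · have h2 : 0 ≤ ∑ n, K n := Finset.sum_nonneg fun n _ => hK0 n
    have h3 : |∑ n, a n x * y n| ≤ ∑ n, K n * |y n| := by
      refine (Finset.abs_sum_le_sum_abs _ _).trans (Finset.sum_le_sum fun n _ => ?_)
      rw [abs_mul]
      exact mul_le_mul_of_nonneg_right (hK n x hx) (abs_nonneg _)
    have h4 : |coeff a₀ a y x| ≤ |amax| := by
      rw [abs_of_nonneg (hamin.le.trans (hy x hx).1)]
      exact (hy x hx).2.trans (le_abs_self _)
    have h5 : a₀ x = coeff a₀ a y x - ∑ n, a n x * y n := by rw [coeff]; ring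
    rw [h5]
    refine (abs_sub _ _).trans ?_
    linarith
  · have h1 : 0 ≤ ∑ n, K n * |y n| := Finset.sum_nonneg fun n _ => mul_nonneg (hK0 n) (abs_nonneg _)
    have h2 : K n ≤ ∑ n, K n := Finset.single_le_sum (fun n _ => hK0 n) (Finset.mem_univ n)
    linarith [hK n x hx, abs_nonneg amax]

end CoefficientBounds

/-! ### The surplus of the flux and the pointwise estimator. -/

section Flux

variable {N d : ℕ} {D : Set (EuclideanSpace ℝ (Fin d))} {lo hi : Fin N → ℝ}
  {a₀ : EuclideanSpace ℝ (Fin d) → ℝ} {a : Fin N → EuclideanSpace ℝ (Fin d) → ℝ}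

/-- The gradient as a continuous linear map. -/
noncomputable def gradL (𝕜 : Type) [RCLike 𝕜] (D : Set (EuclideanSpace ℝ (Fin d))) :
    H10 𝕜 D →L[𝕜] Lp (EuclideanSpace 𝕜 (Fin d)) 2 (domainMeasure D) :=
  (WithLp.sndL 2 𝕜 _ _).comp (Submodule.subtypeL _)

lemma map_sparseInterp {X Y : Type*} [AddCommGroup X] [Module ℝ X] [AddCommGroup Y] [Module ℝ Y]
    (φ : X →ₗ[ℝ] Y) (lo hi : Fin N → ℝ) (I : Finset (Fin N → ℕ)) (F : (Fin N → ℝ) → X)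
    (y : Fin N → ℝ) :
    φ (sparseInterp lo hi I F y) = sparseInterp lo hi I (fun y => φ (F y)) y := by
  rw [sparseInterp, map_sum]
  exact Finset.sum_congr rfl fun i _ => map_surplus φ lo hi i F y

/-- The flux depends on `y` through `∇S_I[u]` and `yₙ ∇S_I[u]`. -/
lemma surplus_flux_ae_eq (u : (Fin N → ℝ) → H10 ℝ D) (i : Fin N → ℕ) (I : Finset (Fin N → ℕ))
    (y : Fin N → ℝ) :
    surplus lo hi i (flux lo hi a₀ a u I) y =ᵐ[domainMeasure D] fun x =>
      a₀ x • surplus lo hi i (fun y => (sparseInterp lo hi I u y).grad) y x +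
      ∑ n, a n x • surplus lo hi i (fun y => y n • (sparseInterp lo hi I u y).grad) y x := by
  -- The flux is a genuine function of `x` while gradients are classes in `L²`. The a.e. identity
  -- relating them defines a subspace of this product, which surpluses preserve.
  let P := (EuclideanSpace ℝ (Fin d) → EuclideanSpace ℝ (Fin d)) ×
    Lp (EuclideanSpace ℝ (Fin d)) 2 (domainMeasure D) ×
    (Fin N → Lp (EuclideanSpace ℝ (Fin d)) 2 (domainMeasure D))
  let R : Submodule ℝ P :=
    { carrier := {p | p.1 =ᵐ[domainMeasure D] fun x => a₀ x • p.2.1 x + ∑ n, a n x • p.2.2 n x}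
      zero_mem' := by
        filter_upwards [Lp.coeFn_zero (EuclideanSpace ℝ (Fin d)) 2 (domainMeasure D)] with x hx
        change (0 : EuclideanSpace ℝ (Fin d)) = a₀ x •
          (0 : Lp (EuclideanSpace ℝ (Fin d)) 2 (domainMeasure D)) x +
          ∑ n, a n x • (0 : Lp (EuclideanSpace ℝ (Fin d)) 2 (domainMeasure D)) x
        simp only [hx, Pi.zero_apply, smul_zero, Finset.sum_const_zero, add_zero]
      add_mem' := by
        intro p q hp hq
        filter_upwards [hp, hq, Lp.coeFn_add p.2.1 q.2.1,
          ae_all_iff.2 fun n => Lp.coeFn_add (p.2.2 n) (q.2.2 n)] with x h1 h2 h3 h4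
        change p.1 x + q.1 x = a₀ x • (p.2.1 + q.2.1) x + ∑ n, a n x • (p.2.2 n + q.2.2 n) x
        simp only [Pi.add_apply, h1, h2, h3, h4, smul_add,
          Finset.sum_add_distrib]
        abel
      smul_mem' := by
        intro c p hp
        filter_upwards [hp, Lp.coeFn_smul c p.2.1,
          ae_all_iff.2 fun n => Lp.coeFn_smul c (p.2.2 n)] with x h1 h2 h3
        change c • p.1 x = a₀ x • (c • p.2.1) x + ∑ n, a n x • (c • p.2.2 n) x
        simp only [Pi.smul_apply, h1, h2, h3, smul_add,
          Finset.smul_sum, smul_comm c] }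
  let G : (Fin N → ℝ) → P := fun y => (flux lo hi a₀ a u I y, (sparseInterp lo hi I u y).grad,
    fun n => y n • (sparseInterp lo hi I u y).grad)
  have hG : ∀ y, G y ∈ R := by
    intro y
    change flux lo hi a₀ a u I y =ᵐ[domainMeasure D] _
    filter_upwards [ae_all_iff.2 fun n => Lp.coeFn_smul (y n) (sparseInterp lo hi I u y).grad]
      with x hx
    simp only [G, flux, coeff, hx, Pi.smul_apply, smul_smul, add_smul, Finset.sum_smul]
  have key := surplus_mem R lo hi i G hG y
  have e1 : (surplus lo hi i G y).1 = surplus lo hi i (flux lo hi a₀ a u I) y :=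
    map_surplus (LinearMap.fst ℝ _ _ : P →ₗ[ℝ] _) lo hi i G y
  have e2 : (surplus lo hi i G y).2.1 =
      surplus lo hi i (fun y => (sparseInterp lo hi I u y).grad) y :=
    map_surplus (LinearMap.fst ℝ _ _ ∘ₗ LinearMap.snd ℝ _ _ : P →ₗ[ℝ] _) lo hi i G y
  have e3 : ∀ n, (surplus lo hi i G y).2.2 n =
      surplus lo hi i (fun y => y n • (sparseInterp lo hi I u y).grad) y := fun n =>
    map_surplus (LinearMap.proj n ∘ₗ LinearMap.snd ℝ _ _ ∘ₗ LinearMap.snd ℝ _ _ : P →ₗ[ℝ] _) lo hi i G y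
  rw [← e1, ← e2]
  simp only [← e3]
  exact key

lemma eLpNorm_smul_coeFn_le (hD : IsOpen D) {b : EuclideanSpace ℝ (Fin d) → ℝ} {K : ℝ}
    (hK : 0 ≤ K) (hb : ∀ x ∈ D, |b x| ≤ K)
    (g : Lp (EuclideanSpace ℝ (Fin d)) 2 (domainMeasure D)) :
    eLpNorm (fun x => b x • g x) 2 (domainMeasure D) ≤ ENNReal.ofReal (K * ‖g‖) := by
  rw [ENNReal.ofReal_mul hK, Lp.norm_def, ENNReal.ofReal_toReal (Lp.eLpNorm_ne_top g)]
  refine eLpNorm_le_mul_eLpNorm_of_ae_le_mul ?_ 2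
  filter_upwards [ae_restrict_mem hD.measurableSet] with x hx
  rw [norm_smul, Real.norm_eq_abs]
  exact mul_le_mul_of_nonneg_right (hb x hx) (norm_nonneg _)

lemma eLpNorm_surplus_flux_le (hD : IsOpen D) (ha₀_meas : AEMeasurable a₀ (domainMeasure D))
    (ha_meas : ∀ n, AEMeasurable (a n) (domainMeasure D)) {K : ℝ} (hK : 0 ≤ K)
    (hb : ∀ x ∈ D, |a₀ x| ≤ K ∧ ∀ n, |a n x| ≤ K) (u : (Fin N → ℝ) → H10 ℝ D) (i : Fin N → ℕ)
    (I : Finset (Fin N → ℕ)) (y : Fin N → ℝ) :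
    eLpNorm (surplus lo hi i (flux lo hi a₀ a u I) y) 2 (domainMeasure D) ≤ ENNReal.ofReal
      (K * (‖surplus lo hi i (fun y => (sparseInterp lo hi I u y).grad) y‖ +
        ∑ n, ‖surplus lo hi i (fun y => y n • (sparseInterp lo hi I u y).grad) y‖)) := by
  set g := surplus lo hi i (fun y => (sparseInterp lo hi I u y).grad) y with hg
  set g' := fun n => surplus lo hi i (fun y => y n • (sparseInterp lo hi I u y).grad) y with hg'
  rw [eLpNorm_congr_ae (surplus_flux_ae_eq u i I y), mul_add, Finset.mul_sum,
    ENNReal.ofReal_add (by positivity) (Finset.sum_nonneg fun n _ => by positivity),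
    ENNReal.ofReal_sum_of_nonneg fun n _ => by positivity]
  have m : ∀ n, AEStronglyMeasurable (fun x => a n x • g' n x) (domainMeasure D) := fun n =>
    (ha_meas n).aestronglyMeasurable.smul (Lp.aestronglyMeasurable _)
  have hsum : (fun x => ∑ n, a n x • g' n x) = ∑ n, fun x => a n x • g' n x := by
    funext x; simp
  refine (eLpNorm_add_le (f := fun x => a₀ x • g x) (g := fun x => ∑ n, a n x • g' n x)
    (ha₀_meas.aestronglyMeasurable.smul (Lp.aestronglyMeasurable _)) ?_ (by norm_num)).trans
    (add_le_add (eLpNorm_smul_coeFn_le hD hK (fun x hx => (hb x hx).1) g) ?_)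
  · rw [hsum]
    exact Finset.aestronglyMeasurable_sum _ fun n _ => m n
  · rw [hsum]
    exact (eLpNorm_sum_le (fun n _ => m n) (by norm_num)).trans (Finset.sum_le_sum fun n _ =>
      eLpNorm_smul_coeFn_le hD hK (fun x hx => (hb x hx).2 n) (g' n))

/-- The isometric complexification commutes with surpluses, so the real norms are those of the
holomorphic extension; `1 + 2N` counts the surviving terms. -/
lemma zeta_le {τ : Fin N → ℝ} (hlohi : ∀ n, lo n < hi n) (hτ : ∀ n, 0 < τ n) (hD : IsOpen D)
    (ha₀_meas : AEMeasurable a₀ (domainMeasure D))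
    (ha_meas : ∀ n, AEMeasurable (a n) (domainMeasure D)) {K : ℝ} (hK : 0 ≤ K)
    (hb : ∀ x ∈ D, |a₀ x| ≤ K ∧ ∀ n, |a n x| ≤ K) {u : (Fin N → ℝ) → H10 ℝ D}
    {U : (Fin N → ℂ) → H10 ℂ D} {M : ℝ} (hU : AnalyticOnNhd ℂ U (Sig lo hi τ))
    (huU : ∀ y ∈ Icc lo hi, ((U fun n => (y n : ℂ)).value : EuclideanSpace ℝ (Fin d) → ℂ)
      =ᵐ[domainMeasure D] fun x => ((u y).value x : ℂ))
    (hM : ∀ z ∈ Sig lo hi τ, ‖(U z).grad‖ ≤ M) {I : Finset (Fin N → ℕ)} (hI : IsIndexSet I)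
    {i : Fin N → ℕ} (hi1 : ∀ n, 1 ≤ i n) :
    zeta lo hi a₀ a u i I ≤ ENNReal.ofReal (K * ((1 + 2 * N) *
      ((∏ n, detailConst (lo n) (hi n) (τ n)) * Real.exp (-rate lo hi τ * shiftedLevel i) * M))) := by
  refine essSup_le_of_ae_le _ ?_
  filter_upwards [ae_restrict_mem measurableSet_Icc] with y hy
  refine (eLpNorm_surplus_flux_le hD ha₀_meas ha_meas hK hb u i I y).trans
    (ENNReal.ofReal_le_ofReal (mul_le_mul_of_nonneg_left ?_ hK))
  let F : (Fin N → ℂ) → Lp (EuclideanSpace ℂ (Fin d)) 2 (domainMeasure D) := fun z => (U z).grad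
  let J : H10 ℝ D →ₗ[ℝ] Lp (EuclideanSpace ℂ (Fin d)) 2 (domainMeasure D) :=
    (complexifyLp D).toLinearMap ∘ₗ (gradL ℝ D).toLinearMap
  have hF : ∀ y ∈ Icc lo hi, J (u y) = F fun n => (y n : ℂ) :=
    fun y hy => (grad_eq_complexifyLp_grad hD (huU y hy)).symm
  have hd : ∀ z ∈ Sig lo hi τ, DifferentiableAt ℂ F z := fun z hz =>
    (gradL ℂ D).differentiableAt.comp z (hU z hz).differentiableAt
  have hJ : ∀ y, complexifyLp D (sparseInterp lo hi I u y).grad =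
      sparseInterp lo hi I (fun y => J (u y)) y := map_sparseInterp J lo hi I u
  have h1 := norm_surplus_sparseInterp_le hlohi hτ hd hM hF hi1 hI hy
  have h2 := fun n => norm_surplus_smul_sparseInterp_le hlohi hτ hd hM hF hi1 hI n hy
  have e1 : ‖surplus lo hi i (fun y => (sparseInterp lo hi I u y).grad) y‖ =
      ‖surplus lo hi i (sparseInterp lo hi I fun y => J (u y)) y‖ := by
    rw [← norm_complexifyLp]
    refine congrArg norm ((map_surplus (complexifyLp D).toLinearMap lo hi i _ y).trans ?_)
    exact congrFun (congrArg _ (funext hJ)) y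
  have e2 : ∀ n, ‖surplus lo hi i (fun y => y n • (sparseInterp lo hi I u y).grad) y‖ =
      ‖surplus lo hi i (fun y => y n • sparseInterp lo hi I (fun y => J (u y)) y) y‖ := by
    intro n
    rw [← norm_complexifyLp]
    refine congrArg norm ((map_surplus (complexifyLp D).toLinearMap lo hi i _ y).trans ?_)
    refine congrFun (congrArg _ (funext fun y => ?_)) y
    rw [map_smul, ← hJ]
    rfl
  simp only [e1, e2]
  refine (add_le_add h1 (Finset.sum_le_sum fun n _ => h2 n)).trans_eq ?_
  rw [Finset.sum_const, Finset.card_univ, Fintype.card_fin, nsmul_eq_mul]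
  ring

end Flux

/-! ### Summation over multi-indices. -/

section Summation

variable {N : ℕ} {lo hi τ : Fin N → ℝ}

lemma rate_pos [NeZero N] (hlohi : ∀ n, lo n < hi n) (hτ : ∀ n, 0 < τ n) : 0 < rate lo hi τ := by
  obtain ⟨n, hn⟩ := exists_eq_ciInf_of_finite (f := fun n =>
    Real.log (2 * τ n / (hi n - lo n) + √(1 + 4 * τ n ^ 2 / (hi n - lo n) ^ 2)))
  rw [rate, ← hn]
  exact Real.log_pos (one_lt_ellipseParam (hlohi n) (hτ n))

/-- Since `m(k - 1) ≥ k - 1`, comparison with `k² e^{-sk}` suffices, at the price of a factor `e^s`.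
-/
lemma summable_sq_mul_exp {s : ℝ} (hs : 0 < s) :
    Summable fun k : ℕ => (k : ℝ) ^ 2 * Real.exp (-s * doubling (k - 1)) := by
  refine Summable.of_nonneg_of_le (fun k => by positivity) (fun k => ?_)
    ((Real.summable_pow_mul_exp_neg_nat_mul 2 hs).mul_left (Real.exp s))
  rw [mul_left_comm, ← Real.exp_add]
  refine mul_le_mul_of_nonneg_left (Real.exp_le_exp.2 ?_) (by positivity)
  have h1 : k ≤ doubling (k - 1) + 1 := by
    have := doubling_strictMono.le_apply (x := k - 1)
    omega
  have h2 : (k : ℝ) ≤ doubling (k - 1) + 1 := by exact_mod_cast h1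
  nlinarith

/-- Enclose the finite set in the box spanned by its projections, over which the sum of products is
a product of sums. -/
lemma sum_prod_le_tsum_pow {φ : ℕ → ℝ} (h0 : ∀ k, 0 ≤ φ k) (hφ : Summable φ)
    (s : Finset (Fin N → ℕ)) : ∑ i ∈ s, ∏ n, φ (i n) ≤ (∑' k, φ k) ^ N := by
  calc ∑ i ∈ s, ∏ n, φ (i n)
      ≤ ∑ i ∈ Fintype.piFinset fun n => s.image fun i => i n, ∏ n, φ (i n) :=
        Finset.sum_le_sum_of_subset_of_nonneg
          (fun i hi => Fintype.mem_piFinset.2 fun n => Finset.mem_image_of_mem _ hi)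
          fun i _ _ => Finset.prod_nonneg fun n _ => h0 _
    _ = ∏ n, ∑ k ∈ s.image fun i => i n, φ k := (Finset.prod_univ_sum _ _).symm
    _ ≤ ∏ _n : Fin N, ∑' k, φ k := Finset.prod_le_prod
        (fun n _ => Finset.sum_nonneg fun k _ => h0 k) fun n _ => hφ.sum_le_tsum _ fun k _ => h0 k
    _ = _ := by simp

lemma sq_Lam_mul_exp (s : ℝ) (i : Fin N → ℕ) :
    (Lam i : ℝ) ^ 2 * Real.exp (-s * shiftedLevel i) =
      ∏ n, ((i n : ℝ) ^ 2 * Real.exp (-s * doubling (i n - 1))) := by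
  rw [Finset.prod_mul_distrib, Finset.prod_pow, ← Real.exp_sum, ← Finset.mul_sum, Lam, shiftedLevel]
  push_cast
  rfl

lemma IsAdaptiveRun.isIndexSet {P : (Fin N → ℕ) → Finset (Fin N → ℕ) → ℝ≥0∞}
    {I : ℕ → Finset (Fin N → ℕ)} (hI : IsAdaptiveRun P I) (l : ℕ) : IsIndexSet (I l) := by
  induction l with
  | zero =>
    intro i hi n
    rw [hI.1, Finset.mem_singleton] at hi
    rw [hi]
  | succ l ih =>
    intro j hj n
    obtain ⟨i, -, hi⟩ := hI.2 l
    rw [hi, Finset.mem_union] at hj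
    rcases hj with hj | hj
    · exact ih j hj n
    · exact (Finset.mem_Icc.1 (Finset.mem_sdiff.1 hj).1).1 n

end Summation

end SparseGrid

/-! ### The proposition. -/

open SparseGrid
theorem mainTheorem6 {N d : ℕ}
    -- parameter domain `Γ = ∏ₙ [loₙ, hiₙ]` and size of the domain of holomorphy
    (lo hi : Fin N → ℝ) (hlohi : ∀ n, lo n < hi n)
    (τ : Fin N → ℝ) (hτ : ∀ n, 0 < τ n)
    -- densities of the random parameters
    (ρ : Fin N → ℝ → ℝ≥0) (hρ_meas : ∀ n, Measurable (ρ n))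
    (hρ_one : ∀ n, ∫⁻ t in Icc (lo n) (hi n), (ρ n t : ℝ≥0∞) = 1)
    -- spatial domain and affine, uniformly elliptic diffusion coefficient
    (D : Set (EuclideanSpace ℝ (Fin d))) (hD : IsOpen D)
    (a₀ : EuclideanSpace ℝ (Fin d) → ℝ) (a : Fin N → EuclideanSpace ℝ (Fin d) → ℝ)
    (ha₀_meas : AEMeasurable a₀ (domainMeasure D))
    (ha_meas : ∀ n, AEMeasurable (a n) (domainMeasure D))
    (amin amax : ℝ) (hamin : 0 < amin)
    (ha : ∀ᵐ y ∂(paramLaw lo hi ρ), ∀ x ∈ D, amin ≤ coeff a₀ a y x ∧ coeff a₀ a y x ≤ amax) :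
    -- the constants depend neither on `u` (except through the bound `M`), nor on `I`, `i`, `ℓ`
    ∃ C B : ℝ, 0 < C ∧ 0 < B ∧
      ∀ (u : (Fin N → ℝ) → H10 ℝ D) (U : (Fin N → ℂ) → H10 ℂ D) (M : ℝ),
        -- `U` is a bounded holomorphic extension of `u` to `Σ(Γ, τ)`
        AnalyticOnNhd ℂ U (Sig lo hi τ) →
        (∀ y ∈ Icc lo hi,
          ((U fun n => (y n : ℂ)).value : EuclideanSpace ℝ (Fin d) → ℂ)
            =ᵐ[domainMeasure D] fun x => ((u y).value x : ℂ)) →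
        (∀ z ∈ Sig lo hi τ, ‖(U z).grad‖ ≤ M) →
        -- the pointwise estimators
        (∀ I : Finset (Fin N → ℕ), IsIndexSet I → ∀ i ∈ margin I,
          zeta lo hi a₀ a u i I ≤ ENNReal.ofReal
            (C * M * (N * (Lam i : ℝ) ^ 2 * Real.exp (-rate lo hi τ * shiftedLevel i)))) ∧
        -- the parametric estimators, for all index sets
        (∀ I : Finset (Fin N → ℕ), IsIndexSet I →
          zetaSC lo hi a₀ a u I ≤ ENNReal.ofReal (B * M)) ∧
        -- the parametric estimators along the algorithm, for either choice of the profit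
        (∀ P, (P = worklessProfit lo hi a₀ a u ∨ P = profitWithWork lo hi a₀ a u) →
          ∀ I : ℕ → Finset (Fin N → ℕ), IsAdaptiveRun P I →
            ∀ ℓ, zetaSC lo hi a₀ a u (I ℓ) ≤ ENNReal.ofReal (B * M)) := by
  obtain ⟨K, hK, hb⟩ := exists_bound_coeff hρ_one hamin ha
  set Q := ∏ n, detailConst (lo n) (hi n) (τ n) with hQ
  have hQ0 : 0 < Q := Finset.prod_pos fun n _ =>
    zero_lt_one.trans_le (one_le_detailConst (hlohi n) (hτ n))
  set φ : ℕ → ℝ := fun k => (k : ℝ) ^ 2 * Real.exp (-rate lo hi τ * doubling (k - 1)) with hφ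
  have hφ0 : ∀ k, 0 ≤ φ k := fun k => by positivity
  have hS0 : 0 ≤ (∑' k, φ k) ^ N := pow_nonneg (tsum_nonneg hφ0) N
  have hC : 0 < 3 * K * Q := by positivity
  -- The summand `1` keeps the second constant positive when `N = 0`.
  refine ⟨3 * K * Q, 3 * K * Q * N * (∑' k, φ k) ^ N + 1, hC, by positivity,
    fun u U M hU huU hM => ?_⟩
  have hM0 : 0 ≤ M := (norm_nonneg _).trans
    (hM _ (ofReal_mem_Sig hτ (y := lo) ⟨le_rfl, fun n => (hlohi n).le⟩))
  have hpoint : ∀ I : Finset (Fin N → ℕ), IsIndexSet I → ∀ i ∈ margin I,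
      zeta lo hi a₀ a u i I ≤ ENNReal.ofReal
        (3 * K * Q * M * (N * (Lam i : ℝ) ^ 2 * Real.exp (-rate lo hi τ * shiftedLevel i))) := by
    rintro I hI i ⟨hi1, n, -⟩
    refine (zeta_le hlohi hτ hD ha₀_meas ha_meas hK.le hb hU huU hM hI hi1).trans
      (ENNReal.ofReal_le_ofReal ?_)
    -- A margin index has a coordinate above `1`, so `N ≥ 1`. The analytic bound has only the factor
    -- `1 + 2N`, which `3 N Λ²` dominates.
    have hN : (1 : ℝ) ≤ N := by exact_mod_cast n.pos
    have hL : (1 : ℝ) ≤ (Lam i : ℝ) ^ 2 := by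
      refine one_le_pow₀ ?_
      exact_mod_cast Finset.one_le_prod' fun n _ => hi1 n
    have hNL : (1 + 2 * N : ℝ) ≤ 3 * (N * (Lam i : ℝ) ^ 2) := by nlinarith
    calc _ = (1 + 2 * N : ℝ) * (K * Q * Real.exp (-rate lo hi τ * shiftedLevel i) * M) := by ring
      _ ≤ 3 * (N * (Lam i : ℝ) ^ 2) *
          (K * Q * Real.exp (-rate lo hi τ * shiftedLevel i) * M) := by gcongr
      _ = _ := by ring
  have htotal : ∀ I : Finset (Fin N → ℕ), IsIndexSet I → zetaSC lo hi a₀ a u I ≤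
      ENNReal.ofReal ((3 * K * Q * N * (∑' k, φ k) ^ N + 1) * M) := by
    intro I hI
    rw [zetaSC, ENNReal.tsum_eq_iSup_sum]
    refine iSup_le fun s => ?_
    -- For `N = 0` the rate is an infimum over the empty type, so `0`, and there is no decay; but
    -- then the margin is empty.
    rcases Nat.eq_zero_or_pos N with rfl | hN
    · have : IsEmpty (margin I) := ⟨fun ⟨_, _, n, _⟩ => n.elim0⟩
      simp [Finset.eq_empty_of_isEmpty s]
    have : NeZero N := ⟨hN.ne'⟩
    have hsum := summable_sq_mul_exp (rate_pos hlohi hτ)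
    refine (Finset.sum_le_sum fun (i : margin I) _ => hpoint I hI i i.2).trans ?_
    rw [← ENNReal.ofReal_sum_of_nonneg fun i _ => by positivity]
    refine ENNReal.ofReal_le_ofReal ?_
    have key := sum_prod_le_tsum_pow hφ0 hsum (s.map (Function.Embedding.subtype _))
    rw [Finset.sum_map] at key
    have hterm : ∀ i : Fin N → ℕ, 3 * K * Q * M *
        (N * (Lam i : ℝ) ^ 2 * Real.exp (-rate lo hi τ * shiftedLevel i)) =
        3 * K * Q * M * N * ∏ n, φ (i n) := by
      intro i
      rw [mul_assoc (N : ℝ), sq_Lam_mul_exp, ← mul_assoc]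
    simp only [hterm]
    rw [← Finset.mul_sum]
    refine (mul_le_mul_of_nonneg_left key (by positivity)).trans ?_
    nlinarith
  exact ⟨hpoint, htotal, fun P _ I hI l => htotal (I l) (hI.isIndexSet l)⟩
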